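/- Let $k$ be an algebraically closed field of characteristic $p \ge 3$ and let $q \ge 5$ be a power of $p$. For an irreducible plane curve $C \subset \mathbb{P}^2$ over $k$ with function field $k(C)$, a point $P \in \mathbb{P}^2$ is called a Galois point for $C$ if the field extension $k(C)/\pi_P^*k(\mathbb{P}^1)$ induced by the projection $\pi_P$ from $P$ is Galois; its Galois group is denoted by $G_P$. A Galois point is called inner if it is a smooth point of $C$. Consider the morphism $$\varphi_1 : \mathbb{P}^1 \to \mathbb{P}^2, \quad (s:t) \mapsto \left(s^{\frac{q+1}{2}}t^{\frac{q-1}{2}} : (s-t)t^{q-1} : s^q - st^{q-1}\right).$$ Its image $C_1$ is an irreducible plane curve of degree $q$, and the following hold. (a) The point $P_1 := (0:1:0) = \varphi_1(0:1)$ is an inner Galois point for $C_1$ with $G_{P_1} \cong D_{q-1}$, where $D_{q-1}$ is the dihedral group of order $q-1$ (for $q = 5$, the Klein four-group). (b) The point $P_2 := (1:0:0) = \varphi_1(1:1)$ is an inner Galois point for $C_1$ with $G_{P_2} \cong \mathbb{Z}/(q-1)\mathbb{Z}$. (c) The number of inner Galois points for $C_1$ is exactly two; that is, $P_1$ and $P_2$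 are the only ones. -/

import Mathlib

open scoped LinearAlgebra.Projectivization

noncomputable section

/-- An irreducible plane curve in the projective plane over `k`, given by an irreducible
homogeneous form (its equation, unique up to a nonzero scalar). -/
structure PlaneCurve (k : Type*) [Field k] where
  /-- the defining equation -/
  form : MvPolynomial (Fin 3) k
  /-- the degree of the curve -/
  degree : ℕ
  irreducible : Irreducible form
  isHomogeneous : form.IsHomogeneous degree

namespace PlaneCurve

variable {k : Type*} [Field k] (C : PlaneCurve k)

/-- The set of points of the curve in the projective plane. As the form is homogeneous, the
condition does not depend on the representative. -/
def points : Set (ℙ k (Fin 3 → k)) :=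
  {P | MvPolynomial.eval P.rep C.form = 0}

/-- A point of the curve at which the equation has a nonzero partial derivative. -/
def IsSmoothPoint (P : ℙ k (Fin 3 → k)) : Prop :=
  P ∈ C.points ∧ ∃ i, MvPolynomial.eval P.rep (MvPolynomial.pderiv i C.form) ≠ 0

/-- The homogeneous coordinate ring `k[X, Y, Z] / (F)`. -/
abbrev CoordRing : Type _ :=
  MvPolynomial (Fin 3) k ⧸ Ideal.span {C.form}

instance isPrime_span : (Ideal.span {C.form}).IsPrime :=
  (Ideal.span_singleton_prime C.irreducible.ne_zero).2 C.irreducible.prime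

/-- The field of fractions of the homogeneous coordinate ring. -/
abbrev ConeField : Type _ := FractionRing C.CoordRing

/-- The class of a polynomial in the fraction field of the homogeneous coordinate ring. -/
def toConeField : MvPolynomial (Fin 3) k →ₐ[k] C.ConeField :=
  (IsScalarTower.toAlgHom k C.CoordRing C.ConeField).comp
    (Ideal.Quotient.mkₐ k (Ideal.span {C.form}))

/-- The function field `k(C)`: all quotients `a / b` of forms of the same degree, `b` not zero
on the curve. -/
def functionField : IntermediateField k C.ConeField where
  carrier := {f | ∃ (d : ℕ) (a b : MvPolynomial (Fin 3) k), a.IsHomogeneous d ∧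
    b.IsHomogeneous d ∧ C.toConeField b ≠ 0 ∧ f = C.toConeField a / C.toConeField b}
  mul_mem' := by
    rintro _ _ ⟨d, a, b, ha, hb, hb0, rfl⟩ ⟨e, a', b', ha', hb', hb0', rfl⟩
    refine ⟨d + e, a * a', b * b', ha.mul ha', hb.mul hb', ?_, ?_⟩
    · rw [map_mul]; exact mul_ne_zero hb0 hb0'
    · rw [map_mul, map_mul, div_mul_div_comm]
  add_mem' := by
    rintro _ _ ⟨d, a, b, ha, hb, hb0, rfl⟩ ⟨e, a', b', ha', hb', hb0', rfl⟩
    refine ⟨d + e, a * b' + b * a', b * b', (ha.mul hb').add (hb.mul ha'), hb.mul hb', ?_, ?_⟩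
    · rw [map_mul]; exact mul_ne_zero hb0 hb0'
    · rw [map_add, map_mul, map_mul, map_mul, div_add_div _ _ hb0 hb0']
  algebraMap_mem' := by
    intro r
    refine ⟨0, MvPolynomial.C r, 1, MvPolynomial.isHomogeneous_C _ _,
      MvPolynomial.isHomogeneous_one _ _, ?_, ?_⟩
    · rw [map_one]; exact one_ne_zero
    · rw [map_one, div_one, ← MvPolynomial.algebraMap_eq, AlgHom.commutes]
  inv_mem' := by
    rintro _ ⟨d, a, b, ha, hb, hb0, rfl⟩
    by_cases ha0 : C.toConeField a = 0
    · refine ⟨d, a, b, ha, hb, hb0, ?_⟩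
      rw [ha0, zero_div, inv_zero]
    · exact ⟨d, b, a, hb, ha, ha0, inv_div _ _⟩

/-- The subfield `π_P^* k(ℙ¹)` of `k(C)`, where `π_P` is the projection from the point `P`. The
projection is given by two independent linear forms that vanish at `P`, and its pulled-back
functions are generated over `k` by the quotients of linear forms vanishing at `P`. -/
def projectionField (P : ℙ k (Fin 3 → k)) : IntermediateField k C.functionField :=
  IntermediateField.adjoin k
    {f | ∃ a b : MvPolynomial (Fin 3) k, a.IsHomogeneous 1 ∧ b.IsHomogeneous 1 ∧
      MvPolynomial.eval P.rep a = 0 ∧ MvPolynomial.eval P.rep b = 0 ∧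
      C.toConeField b ≠ 0 ∧ (f : C.ConeField) = C.toConeField a / C.toConeField b}

/-- `P` is a Galois point for `C` if `k(C) / π_P^* k(ℙ¹)` is a Galois extension. -/
def IsGaloisPoint (P : ℙ k (Fin 3 → k)) : Prop :=
  IsGalois (C.projectionField P) C.functionField

/-- A Galois point is inner if it is a smooth point of the curve. -/
def IsInnerGaloisPoint (P : ℙ k (Fin 3 → k)) : Prop :=
  C.IsGaloisPoint P ∧ C.IsSmoothPoint P

/-- The group `G_P` of automorphisms of `k(C)` over `π_P^* k(ℙ¹)`. -/
abbrev galoisGroup (P : ℙ k (Fin 3 → k)) : Type _ :=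
  C.functionField ≃ₐ[C.projectionField P] C.functionField

end PlaneCurve

/-- The point `(s : t)` of the projective line. -/
def linePoint {k : Type*} [Field k] (s t : k) (h : (![s, t] : Fin 2 → k) ≠ 0) :
    ℙ k (Fin 2 → k) :=
  Projectivization.mk k ![s, t] h

/-- The point `(x : y : z)` of the projective plane. -/
def planePoint {k : Type*} [Field k] (x y z : k) (h : (![x, y, z] : Fin 3 → k) ≠ 0) :
    ℙ k (Fin 3 → k) :=
  Projectivization.mk k ![x, y, z] h

/-- The homogeneous coordinates of `φ₁(s : t)`. -/
def phiVec {k : Type*} [Field k] (q : ℕ) (v : Fin 2 → k) : Fin 3 → k :=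
  ![v 0 ^ ((q + 1) / 2) * v 1 ^ ((q - 1) / 2),
    (v 0 - v 1) * v 1 ^ (q - 1),
    v 0 ^ q - v 0 * v 1 ^ (q - 1)]

theorem phiVec_ne_zero {k : Type*} [Field k] {q : ℕ} (hq : Odd q) {v : Fin 2 → k}
    (hv : v ≠ 0) : phiVec q v ≠ 0 := by
  intro h
  have h0 : v 0 ^ ((q + 1) / 2) * v 1 ^ ((q - 1) / 2) = 0 := by simpa [phiVec] using congrFun h 0
  have h1 : (v 0 - v 1) * v 1 ^ (q - 1) = 0 := by simpa [phiVec] using congrFun h 1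
  have h2 : v 0 ^ q - v 0 * v 1 ^ (q - 1) = 0 := by simpa [phiVec] using congrFun h 2
  obtain ⟨m, rfl⟩ := hq
  apply hv
  have key : v 0 = 0 ∧ v 1 = 0 := by
    by_cases ht : v 1 = 0
    · refine ⟨?_, ht⟩
      rcases Nat.eq_zero_or_pos m with rfl | hm
      · simpa using h0
      · have hne : 2 * m + 1 - 1 ≠ 0 := by omega
        rw [ht, zero_pow hne, mul_zero, sub_zero] at h2
        exact eq_zero_of_pow_eq_zero h2
    · have hs : v 0 = 0 := by
        rcases mul_eq_zero.1 h0 with h | h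
        · exact eq_zero_of_pow_eq_zero h
        · exact absurd (eq_zero_of_pow_eq_zero h) ht
      rcases mul_eq_zero.1 h1 with h | h
      · rw [hs, zero_sub, neg_eq_zero] at h
        exact absurd h ht
      · exact absurd (eq_zero_of_pow_eq_zero h) ht
  funext i
  fin_cases i
  · exact key.1
  · exact key.2

theorem phiVec_smul {k : Type*} [Field k] {q : ℕ} (hq : Odd q) (c : k) (v : Fin 2 → k) :
    phiVec q (c • v) = c ^ q • phiVec q v := by
  obtain ⟨m, rfl⟩ := hq
  have e1 : (2 * m + 1 + 1) / 2 = m + 1 := by omega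
  have e2 : (2 * m + 1 - 1) / 2 = m := by omega
  have e3 : 2 * m + 1 - 1 = 2 * m := by omega
  funext i
  fin_cases i <;> simp [phiVec, e1] <;> ring

/-- The morphism
`φ₁ : (s : t) ↦ (s^((q+1)/2) t^((q-1)/2) : (s - t) t^(q-1) : s^q - s t^(q-1))`, for odd `q`. -/
def phi {k : Type*} [Field k] (q : ℕ) (hq : Odd q) :
    ℙ k (Fin 2 → k) → ℙ k (Fin 3 → k) :=
  Projectivization.lift
    (fun v => Projectivization.mk k (phiVec q v.1) (phiVec_ne_zero hq v.2))
    (by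
      intro a b t h
      rw [Projectivization.mk_eq_mk_iff']
      exact ⟨t ^ q, by rw [h, phiVec_smul hq]⟩)

theorem odd_of_eq_prime_pow {p q n : ℕ} (hp : p.Prime) (hp3 : 3 ≤ p) (hq : q = p ^ n) :
    Odd q := by
  rw [hq]
  exact (hp.odd_of_ne_two (by omega)).pow

end

/-! ### Ramification in normal extensions of the rational function field -/

section

open Polynomial IntermediateField algebraAdjoinAdjoin

/-! Write q = 2m + 1 and put t = 1. Since φ₁ is birational onto its image, the function field is
k(s), and projection from a point becomes a rational function f of s. Every question is then whether
k(s)/k(f) is Galois.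

From P₁ one gets f = s^m / (s^(2m) - 1), invariant under s ↦ ζs and s ↦ c/s, where ζ is a primitive
m-th root of unity and c^m = -1. From P₂ one gets f = 1 / ((s - 1)^(2m) - 1), invariant under s ↦
ζ(s - 1) + 1 with ζ a primitive 2m-th root of unity. Both functions have degree 2m, so these
substitutions generate the full Galois groups (`RatFunc.isGalois_adjoin_dihedral`,
`RatFunc.isGalois_adjoin_kummer`).

The other points are excluded by ramification: in a Galois cover all points of a fibre have the same
index. Hence if f = A/B in lowest terms vanishes at infinity to order d = deg B - deg A and has a
finite zero, it has a finite zero of order at least d (`RatFunc.exists_pow_dvd_of_normal`). At φ₁(a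
: 1) with a ≠ 0, 1, f is a quotient of two sparse polynomials of degrees m + 1 and 2m + 1, so d = m,
while the numerator has no triple root. Only q = 5 remains, where a double root is also a root of
the denominator (`RatFunc.not_normal_adjoin_trinomials`). At φ₁(1 : 0), f = (s - 1) / s^(m+1).

A curve is known only through its set of points, so its equation must be pinned down. The element w
= s t^(2m) satisfies w² + zw = x² and w^(m+1) = x(w - y)^m; eliminating w gives the form `curveEq`
of degree q. By the Nullstellensatz the equation of the curve divides it. Projection from P₂ has
degree q - 1, which forces the degree of the curve to be at least q (`PlaneCurve.le_degree`). So the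
two forms agree up to a constant, and smoothness is read off from `curveEq`. -/

theorem Polynomial.exists_homogenized_eval {k : Type*} [Field k] (p U V : k[X]) (hV : V ≠ 0)
    (c : k) (hc : V.eval c = 0) :
    ∃ h : k[X], algebraMap k[X] (RatFunc k) h =
        aeval (algebraMap k[X] (RatFunc k) U / algebraMap k[X] (RatFunc k) V) p *
          algebraMap k[X] (RatFunc k) V ^ p.natDegree ∧
      h.eval c = p.leadingCoeff * U.eval c ^ p.natDegree := by
  have hV' : algebraMap k[X] (RatFunc k) V ≠ 0 := RatFunc.algebraMap_ne_zero hV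
  refine ⟨∑ i ∈ Finset.range (p.natDegree + 1), C (p.coeff i) * U ^ i * V ^ (p.natDegree - i),
    ?_, ?_⟩
  · rw [aeval_eq_sum_range, Finset.sum_mul, map_sum]
    refine Finset.sum_congr rfl fun i hi => ?_
    have hi' : i ≤ p.natDegree := by simpa [Nat.lt_succ_iff] using hi
    rw [map_mul, map_mul, map_pow, map_pow, RatFunc.algebraMap_C, RatFunc.smul_eq_C_mul, div_pow]
    rw [← Nat.sub_add_cancel hi', pow_add, Nat.sub_add_cancel hi']
    field_simp
  -- All terms but the top one carry a factor V, which vanishes at c.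
  · rw [eval_finsetSum, Finset.sum_range_succ, Finset.sum_eq_zero]
    · simp
    · intro i hi
      have : p.natDegree - i ≠ 0 := by
        have := Finset.mem_range.1 hi
        omega
      simp [hc, this]

namespace RatFunc

variable {k : Type*} [Field k]

theorem associated_num_denom_of_isCoprime {A B : k[X]} (h : IsCoprime A B) (hB : B ≠ 0) :
    Associated (num (algebraMap k[X] (RatFunc k) A / algebraMap k[X] (RatFunc k) B)) A ∧
    Associated (denom (algebraMap k[X] (RatFunc k) A / algebraMap k[X] (RatFunc k) B)) B := by
  set f := algebraMap k[X] (RatFunc k) A / algebraMap k[X] (RatFunc k) B with hf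
  have key : f.num * B = A * f.denom := (num_mul_eq_mul_denom_iff hB).2 hf
  have hc := f.isCoprime_num_denom
  constructor
  · refine associated_of_dvd_dvd ?_ ?_
    · exact hc.dvd_of_dvd_mul_right (Dvd.intro _ key)
    · exact h.dvd_of_dvd_mul_right (Dvd.intro _ key.symm)
  · refine associated_of_dvd_dvd ?_ ?_
    · exact hc.symm.dvd_of_dvd_mul_left (Dvd.intro_left _ key.symm)
    · exact h.symm.dvd_of_dvd_mul_left (Dvd.intro_left _ key)

theorem natDegree_num_denom_of_isCoprime {A B : k[X]} (h : IsCoprime A B) (hB : B ≠ 0) :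
    (num (algebraMap k[X] (RatFunc k) A / algebraMap k[X] (RatFunc k) B)).natDegree = A.natDegree ∧
    (denom (algebraMap k[X] (RatFunc k) A / algebraMap k[X] (RatFunc k) B)).natDegree =
      B.natDegree :=
  ⟨natDegree_eq_of_degree_eq (degree_eq_degree_of_associated
      (associated_num_denom_of_isCoprime h hB).1),
    natDegree_eq_of_degree_eq (degree_eq_degree_of_associated
      (associated_num_denom_of_isCoprime h hB).2)⟩

theorem finrank_adjoin_div {A B : k[X]} (h : IsCoprime A B) (hB : B ≠ 0) :
    Module.finrank
      k⟮algebraMap k[X] (RatFunc k) A / algebraMap k[X] (RatFunc k) B⟯ (RatFunc k) =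
      max A.natDegree B.natDegree := by
  rw [finrank_eq_max_natDegree, (natDegree_num_denom_of_isCoprime h hB).1,
    (natDegree_num_denom_of_isCoprime h hB).2]

theorem splits_minpolyX (f : RatFunc k) (hf : ¬∃ c, f = C c) [Normal k⟮f⟯ (RatFunc k)] :
    (f.minpolyX (RatFunc k)).Splits := by
  rw [← f.minpolyX_map k⟮f⟯ (RatFunc k)]
  have h := minpoly.eq_of_irreducible (f.irreducible_minpolyX hf) f.minpolyX_aeval_X
  have h2 := Normal.splits (inferInstance : Normal k⟮f⟯ (RatFunc k)) (X : RatFunc k)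
  rw [← h, Polynomial.map_mul] at h2
  have hne : f.minpolyX k⟮f⟯ ≠ 0 := (f.irreducible_minpolyX hf).ne_zero
  refine Splits.of_dvd h2 ?_ (Dvd.intro _ rfl)
  rw [← Polynomial.map_mul]
  exact Polynomial.map_ne_zero (mul_ne_zero hne (by simpa using hne))

/-- The conjugates of X over k(f) are the roots of num(T) - f · denom(T), and they lie in k(X). Some
conjugate r has a pole c. As f(r) = f and f vanishes at infinity to order deg denom - deg num, f
vanishes at c to at least that order. -/
theorem exists_pow_dvd_num_of_normal [IsAlgClosed k] (f : RatFunc k)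
    (hlt : f.num.natDegree < f.denom.natDegree) (hpos : f.num.natDegree ≠ 0)
    [Normal k⟮f⟯ (RatFunc k)] :
    ∃ c, (Polynomial.X - Polynomial.C c) ^ (f.denom.natDegree - f.num.natDegree) ∣ f.num := by
  have hf : ¬∃ c, f = C c := by
    rintro ⟨c, rfl⟩
    simp at hpos
  have hf0 : f ≠ 0 := fun h => hf ⟨0, by simp [h]⟩
  have hsplit := f.splits_minpolyX hf
  set P := f.minpolyX (RatFunc k) with hP
  have hPdef : P = f.num.map (algebraMap k (RatFunc k)) -
      Polynomial.C f * f.denom.map (algebraMap k (RatFunc k)) := rfl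
  have hPdeg : P.natDegree = f.denom.natDegree := by
    rw [hP, ← f.minpolyX_map k⟮f⟯ (RatFunc k), natDegree_map, natDegree_minpolyX]
    exact max_eq_right hlt.le
  have hPlc : P.leadingCoeff = -f := by
    rw [leadingCoeff, hPdeg, hPdef]
    have := f.monic_denom.coeff_natDegree
    simp [coeff_eq_zero_of_natDegree_lt hlt, this]
  -- If all roots were polynomials, P would be -f times a polynomial with coefficients in k[X].
  by_cases hall : ∀ r ∈ P.roots, r ∈ (algebraMap k[X] (RatFunc k)).range
  · exfalso
    have hlift : (P.roots.map fun a => Polynomial.X - Polynomial.C a).prod ∈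
        Polynomial.lifts (algebraMap k[X] (RatFunc k)) := by
      refine Subsemiring.multiset_prod_mem _ _ fun q hq => ?_
      obtain ⟨a, ha, rfl⟩ := Multiset.mem_map.1 hq
      obtain ⟨b, rfl⟩ := hall a ha
      exact ⟨Polynomial.X - Polynomial.C b, by simp⟩
    have heq := hsplit.eq_prod_roots
    rw [hPlc] at heq
    obtain ⟨Q, hQ⟩ := hlift
    -- In this degree the coefficient of P is l - fD with l a nonzero constant, so l is f times a
    -- polynomial. Then the numerator of f divides a constant, although it has positive degree.
    have hco := congrArg (fun p => p.coeff f.num.natDegree) heq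
    rw [← hQ] at hco
    simp only [hPdef, coeff_sub, coeff_map, coeff_natDegree, coeff_C_mul, coe_mapRingHom] at hco
    set D := f.denom.coeff f.num.natDegree
    set l := f.num.leadingCoeff with hl
    have hl0 : l ≠ 0 := leadingCoeff_ne_zero.2 (num_ne_zero hf0)
    set E := Q.coeff f.num.natDegree
    have h1 : algebraMap k (RatFunc k) l =
        f * algebraMap k[X] (RatFunc k) (Polynomial.C D - E) := by
      rw [map_sub, algebraMap_C, ← algebraMap_eq_C]
      linear_combination hco
    have h2 : f.denom * Polynomial.C l = f.num * (Polynomial.C D - E) := by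
      apply algebraMap_injective k
      rw [map_mul, map_mul, algebraMap_C, ← algebraMap_eq_C, h1, ← mul_assoc]
      congr 1
      have := f.num_div_denom
      rw [div_eq_iff (algebraMap_ne_zero f.denom_ne_zero)] at this
      rw [this, mul_comm]
    have h3 : f.num ∣ f.denom * Polynomial.C l := Dvd.intro _ h2.symm
    have h4 : f.num ∣ Polynomial.C l := f.isCoprime_num_denom.dvd_of_dvd_mul_left h3
    have h5 := natDegree_le_of_dvd h4 (by simpa using hl0)
    simp at h5
    exact hpos h5
  · push Not at hall
    obtain ⟨r, hr, hr'⟩ := hall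
    have hrd : r.denom.degree ≠ 0 := by
      intro h
      apply hr'
      have : r.denom = 1 := r.monic_denom.degree_le_zero_iff_eq_one.1 h.le
      exact ⟨r.num, by conv_rhs => rw [← r.num_div_denom, this, map_one, div_one]⟩
    obtain ⟨c, hc⟩ := IsAlgClosed.exists_root r.denom hrd
    refine ⟨c, ?_⟩
    -- `hA` and `hB` are num(r) and denom(r) with the powers of the denominator of r cleared.
    obtain ⟨hA, hA1, hA2⟩ := exists_homogenized_eval f.num r.num r.denom r.denom_ne_zero c hc
    obtain ⟨hB, hB1, hB2⟩ := exists_homogenized_eval f.denom r.num r.denom r.denom_ne_zero c hc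
    rw [num_div_denom] at hA1 hB1
    have hroot : aeval r f.num = f * aeval r f.denom := by
      have := (mem_roots'.1 hr).2
      rw [IsRoot.def, hPdef] at this
      rwa [Polynomial.eval_sub, Polynomial.eval_mul, Polynomial.eval_C, eval_map_algebraMap, eval_map_algebraMap,
        sub_eq_zero] at this
    have hf2 := f.num_div_denom
    rw [div_eq_iff (algebraMap_ne_zero f.denom_ne_zero)] at hf2
    have heq : hA * r.denom ^ (f.denom.natDegree - f.num.natDegree) * f.denom = f.num * hB := by
      apply algebraMap_injective k
      rw [map_mul, map_mul, map_mul, map_pow, hA1, hB1, hf2, hroot]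
      have hp := pow_sub_mul_pow (algebraMap k[X] (RatFunc k) r.denom) hlt.le
      linear_combination f * aeval r f.denom * algebraMap k[X] (RatFunc k) f.denom * hp
    -- At the pole c the value of `hB` is a power of r.num(c), which is nonzero because r is in
    -- lowest terms.
    have hcop : IsCoprime (Polynomial.X - Polynomial.C c) hB := by
      refine ((irreducible_X_sub_C c).coprime_iff_not_dvd).2 fun hd => ?_
      rw [dvd_iff_isRoot, IsRoot.def, hB2, f.monic_denom.leadingCoeff, one_mul] at hd
      have h0 := eq_zero_of_pow_eq_zero hd
      obtain ⟨u, v, huv⟩ := r.isCoprime_num_denom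
      have := congrArg (Polynomial.eval c) huv
      rw [IsRoot.def] at hc
      simp [h0, hc] at this
    refine hcop.pow_left.dvd_of_dvd_mul_right ?_
    rw [← heq, mul_assoc, mul_comm, mul_assoc]
    exact (pow_dvd_pow_of_dvd (dvd_iff_isRoot.2 hc) _).mul_right _

/-- If `A / B` generates a subfield over which `k(X)` is normal and vanishes to order `d` at
infinity, then it vanishes to order at least `d` at a finite point as soon as it has a finite
zero. -/
theorem exists_pow_dvd_of_normal [IsAlgClosed k] {A B : k[X]} (h : IsCoprime A B)
    (hlt : A.natDegree < B.natDegree) (hpos : A.natDegree ≠ 0)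
    (hn : Normal k⟮algebraMap k[X] (RatFunc k) A / algebraMap k[X] (RatFunc k) B⟯ (RatFunc k)) :
    ∃ c, (Polynomial.X - Polynomial.C c) ^ (B.natDegree - A.natDegree) ∣ A := by
  have hB : B ≠ 0 := by
    rintro rfl
    simp at hlt
  obtain ⟨h1, h2⟩ := natDegree_num_denom_of_isCoprime h hB
  obtain ⟨c, hc⟩ := exists_pow_dvd_num_of_normal _ (by rwa [h1, h2]) (by rwa [h1])
  rw [h1, h2] at hc
  exact ⟨c, hc.trans (associated_num_denom_of_isCoprime h hB).1.dvd⟩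

end RatFunc

end

/-- The relations define a homomorphism from the dihedral group. It is injective because ρ has exact
order m and σ is not a rotation, and the bound on the cardinality makes it onto. -/
theorem exists_mulEquiv_dihedralGroup {G : Type*} [Group G] [Finite G] {m : ℕ} (hm : m ≠ 0)
    {ρ σ : G} (hρ : orderOf ρ = m) (hσ : σ * σ = 1) (hρσ : σ * ρ * σ = ρ⁻¹)
    (hn : ∀ n : ℕ, σ ≠ ρ ^ n) (hcard : Nat.card G ≤ 2 * m) :
    Nat.card G = 2 * m ∧ Nonempty (G ≃* DihedralGroup m) := by
  have : NeZero m := ⟨hm⟩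
  let e : ZMod m → G := fun i => ρ ^ i.val
  have he : ∀ n : ℕ, e n = ρ ^ n := fun n => by
    simp only [e, ZMod.val_natCast]
    rw [← hρ, pow_mod_orderOf]
  have hadd : ∀ i j, e (i + j) = e i * e j := fun i j => by
    rw [← ZMod.natCast_zmod_val i, ← ZMod.natCast_zmod_val j, ← Nat.cast_add, he, he, he, pow_add]
  have hneg : ∀ i, e (-i) = (e i)⁻¹ := fun i => by
    rw [eq_inv_iff_mul_eq_one, ← hadd, neg_add_cancel]
    simp [e]
  have hσ' : σ⁻¹ = σ := inv_eq_of_mul_eq_one_left hσ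
  have hconj : ∀ i, e i * σ = σ * e (-i) := fun i => by
    have h1 : ρ * σ = σ * ρ⁻¹ := by
      rw [← hρσ, ← mul_assoc, ← mul_assoc, hσ, one_mul]
    have h2 : SemiconjBy σ ρ⁻¹ ρ := h1.symm
    rw [hneg]
    simpa [e, SemiconjBy] using (h2.pow_right i.val).symm
  let φ : DihedralGroup m →* G := MonoidHom.mk' (fun x => match x with
      | .r i => e i
      | .sr i => σ * e i) (by
    rintro (i | i) (j | j)
    · simp [DihedralGroup.r_mul_r, hadd]
    · simp only [DihedralGroup.r_mul_sr]
      rw [← mul_assoc, hconj, mul_assoc, ← hadd, neg_add_eq_sub]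
    · simp only [DihedralGroup.sr_mul_r]
      rw [hadd, mul_assoc]
    · simp only [DihedralGroup.sr_mul_sr]
      rw [mul_assoc, ← mul_assoc (e i), hconj, mul_assoc, ← hadd, ← mul_assoc, hσ, one_mul,
        neg_add_eq_sub])
  have hφ : Function.Injective φ := by
    rw [injective_iff_map_eq_one]
    rintro (i | i) h
    · have h' : ρ ^ i.val = 1 := h
      have h2 : i.val = 0 := Nat.eq_zero_of_dvd_of_lt
        (hρ.symm.dvd.trans (orderOf_dvd_of_pow_eq_one h')) (ZMod.val_lt i)
      rw [(ZMod.val_eq_zero i).1 h2]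
      rfl
    · have h' : σ * e i = 1 := h
      refine absurd ?_ (hn (-i).val)
      have h3 : σ = (e i)⁻¹ := eq_inv_of_mul_eq_one_left h'
      rw [h3, ← hneg]
  have hle : Nat.card (DihedralGroup m) ≤ Nat.card G := Nat.card_le_card_of_injective φ hφ
  rw [DihedralGroup.nat_card] at hle
  have hc : Nat.card G = 2 * m := le_antisymm hcard hle
  refine ⟨hc, ⟨(MulEquiv.ofBijective φ ?_).symm⟩⟩
  have : Finite (DihedralGroup m) := Finite.of_injective φ hφ
  exact (Nat.bijective_iff_injective_and_card φ).2 ⟨hφ, by rw [hc, DihedralGroup.nat_card]⟩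

/-! ### Rational functions with cyclic and dihedral Galois groups -/

section

open Polynomial IntermediateField algebraAdjoinAdjoin

namespace RatFunc

variable {k : Type*} [Field k]

theorem algHom_ext_of_apply_X {S : Type*} [Field S] [Algebra k S] {σ τ : RatFunc k →ₐ[k] S}
    (h : σ X = τ X) : σ = τ := by
  have hp : ∀ p : k[X], σ (algebraMap k[X] (RatFunc k) p) = τ (algebraMap k[X] (RatFunc k) p) := by
    intro p
    rw [← aeval_X_left_eq_algebraMap, ← aeval_algHom_apply, ← aeval_algHom_apply, h]
  ext x
  rw [← x.num_div_denom, map_div₀, map_div₀, hp, hp]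

theorem algEquiv_ext_of_apply_X {L : IntermediateField k (RatFunc k)}
    {σ τ : RatFunc k ≃ₐ[L] RatFunc k} (h : σ X = τ X) : σ = τ := by
  have := algHom_ext_of_apply_X (σ := (σ.restrictScalars k : RatFunc k →ₐ[k] RatFunc k))
    (τ := (τ.restrictScalars k : RatFunc k →ₐ[k] RatFunc k)) h
  ext x
  exact DFunLike.congr_fun this x

theorem aeval_ne_zero_of_transcendental {h : RatFunc k} (ht : Transcendental k h) {p : k[X]}
    (hp : p ≠ 0) : aeval h p ≠ 0 := fun h0 => ht ⟨p, hp, h0⟩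

/-- A substitution `X ↦ h` that fixes `A / B` is an automorphism over `k(A / B)`. -/
theorem exists_algEquiv_apply_X {A B : k[X]} (hB : B ≠ 0)
    (hfin : FiniteDimensional
      k⟮algebraMap k[X] (RatFunc k) A / algebraMap k[X] (RatFunc k) B⟯ (RatFunc k))
    {h : RatFunc k} (ht : ¬∃ c, h = C c)
    (heq : aeval h A * algebraMap k[X] (RatFunc k) B =
      algebraMap k[X] (RatFunc k) A * aeval h B) :
    ∃ σ : RatFunc k ≃ₐ[k⟮algebraMap k[X] (RatFunc k) A / algebraMap k[X] (RatFunc k) B⟯]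
      RatFunc k, σ X = h := by
  set f := algebraMap k[X] (RatFunc k) A / algebraMap k[X] (RatFunc k) B with hf
  have htr := transcendental_of_ne_C h ht
  let τ : RatFunc k →ₐ[k] RatFunc k :=
    (IntermediateField.val _).comp (algEquivOfTranscendental h htr : RatFunc k →ₐ[k] k⟮h⟯)
  have hτX : τ X = h := algEquivOfTranscendental_X h htr
  have hτ : ∀ p : k[X], τ (algebraMap k[X] (RatFunc k) p) = aeval h p := fun p => by
    rw [← aeval_X_left_eq_algebraMap, ← aeval_algHom_apply, hτX]
  have hτf : τ f = f := by
    rw [hf, map_div₀, hτ, hτ, div_eq_div_iff (aeval_ne_zero_of_transcendental htr hB)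
      (algebraMap_ne_zero hB), heq]
  -- The elements fixed by τ form a subfield containing f, hence all of k(f).
  have hle : k⟮f⟯ ≤ (AlgHom.equalizer τ (AlgHom.id k (RatFunc k))).toIntermediateField (by
      intro x hx
      simp only [AlgHom.mem_equalizer, AlgHom.coe_id, id_eq, map_inv₀] at hx ⊢
      rw [hx]) := by
    rw [adjoin_simple_le_iff]
    exact hτf
  let σ : RatFunc k →ₐ[k⟮f⟯] RatFunc k :=
    { (τ : RatFunc k →+* RatFunc k) with commutes' := fun x => hle x.2 }
  exact ⟨AlgEquiv.ofBijective σ (AlgHom.bijective σ), hτX⟩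


theorem algEquiv_pow_apply_X {L : IntermediateField k (RatFunc k)} {σ : RatFunc k ≃ₐ[L] RatFunc k}
    {a ζ : k} (h : σ X = C ζ * (X - C a) + C a) (n : ℕ) :
    (σ ^ n) X = C (ζ ^ n) * (X - C a) + C a := by
  have hC : ∀ c : k, σ (C c) = C c := fun c =>
    (σ.restrictScalars k).commutes c
  induction n with
  | zero => simp
  | succ n ih =>
    rw [pow_succ', AlgEquiv.mul_apply, ih, map_add, map_mul, map_sub, hC, hC, h, pow_succ, map_mul]
    ring

theorem X_sub_C_ne_zero (a : k) : (X : RatFunc k) - C a ≠ 0 := by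
  rw [← algebraMap_X, ← algebraMap_C, ← map_sub]
  exact algebraMap_ne_zero (Polynomial.X_sub_C_ne_zero a)

theorem orderOf_algEquiv {L : IntermediateField k (RatFunc k)} {σ : RatFunc k ≃ₐ[L] RatFunc k}
    {a ζ : k} (h : σ X = C ζ * (X - C a) + C a) {N : ℕ} (hζ : IsPrimitiveRoot ζ N) :
    orderOf σ = N := by
  rw [hζ.eq_orderOf]
  refine orderOf_eq_orderOf_iff.2 fun n => ?_
  constructor
  · intro h1
    have h2 := algEquiv_pow_apply_X h n
    rw [h1, AlgEquiv.one_apply] at h2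
    apply C_injective
    have : (C (ζ ^ n) - C 1) * ((X : RatFunc k) - C a) = 0 := by
      rw [map_one]
      linear_combination -h2
    exact sub_eq_zero.1 ((mul_eq_zero.1 this).resolve_right (X_sub_C_ne_zero a))
  · intro h1
    apply algEquiv_ext_of_apply_X
    rw [algEquiv_pow_apply_X h n, h1, AlgEquiv.one_apply, map_one]
    ring

theorem ne_C_of_eval {h : RatFunc k} {p q : k[X]}
    (hh : h * algebraMap k[X] (RatFunc k) q = algebraMap k[X] (RatFunc k) p)
    (hd : p.natDegree ≠ q.natDegree) (hp : p ≠ 0) : ¬∃ c, h = C c := by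
  rintro ⟨c, rfl⟩
  rw [← algebraMap_C, ← map_mul] at hh
  have := algebraMap_injective k hh
  apply hd
  have hc : c ≠ 0 := by
    rintro rfl
    rw [map_zero, zero_mul] at this
    exact hp this.symm
  rw [← this, natDegree_C_mul hc]

theorem natDegree_X_sub_one_pow_sub_one {N : ℕ} (hN : N ≠ 0) :
    ((Polynomial.X - 1 : k[X]) ^ N - 1).natDegree = N := by
  have h1 : (Polynomial.X - 1 : k[X]).natDegree = 1 := natDegree_X_sub_C 1
  rw [natDegree_sub_eq_left_of_natDegree_lt] <;> rw [natDegree_pow, h1, mul_one]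
  rw [natDegree_one]
  exact Nat.pos_of_ne_zero hN

variable [IsAlgClosed k]

theorem exists_isPrimitiveRoot_of_ne_zero {N : ℕ} (hN : (N : k) ≠ 0) :
    ∃ ζ : k, IsPrimitiveRoot ζ N := by
  have : NeZero (N : k) := ⟨hN⟩
  have := HasEnoughRootsOfUnity.exists_primitiveRoot k N
  exact this

/-- The function f depends only on (X - 1)^N, so the rotation about 1 by a primitive N-th root of
unity fixes it. Its order equals the degree of the extension. -/
theorem isGalois_adjoin_kummer {N : ℕ} (hN : (N : k) ≠ 0) {f : RatFunc k}
    (hf : f = algebraMap k[X] (RatFunc k) 1 /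
      algebraMap k[X] (RatFunc k) ((Polynomial.X - 1) ^ N - 1)) :
    Module.finrank k⟮f⟯ (RatFunc k) = N ∧ IsGalois k⟮f⟯ (RatFunc k) ∧
    Nonempty ((RatFunc k ≃ₐ[k⟮f⟯] RatFunc k) ≃* Multiplicative (ZMod N)) := by
  have hN0 : N ≠ 0 := by
    rintro rfl
    simp at hN
  have : NeZero N := ⟨hN0⟩
  have hdeg := natDegree_X_sub_one_pow_sub_one (k := k) hN0
  have hB : ((Polynomial.X - 1 : k[X]) ^ N - 1) ≠ 0 := by
    intro h
    rw [h, natDegree_zero] at hdeg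
    exact hN0 hdeg.symm
  have hfr : Module.finrank k⟮f⟯ (RatFunc k) = N := by
    rw [hf, finrank_adjoin_div isCoprime_one_left hB, hdeg]
    simp
  have hfin : FiniteDimensional k⟮f⟯ (RatFunc k) :=
    Module.finite_of_finrank_pos (hfr ▸ Nat.pos_of_ne_zero hN0)
  obtain ⟨ζ, hζ⟩ := exists_isPrimitiveRoot_of_ne_zero hN
  have hζ0 : ζ ≠ 0 := hζ.ne_zero hN0
  have hex : ∃ σ : RatFunc k ≃ₐ[k⟮f⟯] RatFunc k, σ X = C ζ * (X - C 1) + C 1 := by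
    subst hf
    refine exists_algEquiv_apply_X hB hfin ?_ ?_
    · refine ne_C_of_eval (p := Polynomial.C ζ * Polynomial.X + Polynomial.C (1 - ζ)) (q := 1)
        ?_ ?_ ?_
      · simp only [map_one, map_add, map_mul, map_sub, algebraMap_C, algebraMap_X]
        ring
      · rw [natDegree_linear hζ0]
        simp
      · intro h
        have := natDegree_linear (b := 1 - ζ) hζ0
        rw [h] at this
        simp at this
    · have hp : (C ζ : RatFunc k) ^ N = 1 := by rw [← map_pow, hζ.pow_eq_one, map_one]
      simp only [map_one, map_sub, map_pow, aeval_X, algebraMap_X, one_mul, add_sub_cancel_right,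
        mul_pow, hp]
  obtain ⟨σ, hσ⟩ := hex
  have hord := orderOf_algEquiv hσ hζ
  have hcard : Nat.card (RatFunc k ≃ₐ[k⟮f⟯] RatFunc k) = N := by
    apply le_antisymm
    · rw [Nat.card_eq_fintype_card]
      exact AlgEquiv.card_le.trans hfr.le
    · rw [← hord]
      exact orderOf_le_card
  refine ⟨hfr, IsGalois.of_card_aut_eq_finrank _ _ (hcard.trans hfr.symm), ?_⟩
  have : IsCyclic (RatFunc k ≃ₐ[k⟮f⟯] RatFunc k) :=
    isCyclic_of_orderOf_eq_card σ (hord.trans hcard.symm)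
  exact ⟨mulEquivOfCyclicCardEq (by rw [hcard]; simp)⟩

/-- The rotation X ↦ ζX and the involution X ↦ c/X generate 2m automorphisms, as many as the degree
allows. -/
theorem isGalois_adjoin_dihedral {m : ℕ} (hm : (m : k) ≠ 0) {f : RatFunc k}
    (hf : f = algebraMap k[X] (RatFunc k) (Polynomial.X ^ m) /
      algebraMap k[X] (RatFunc k) (Polynomial.X ^ (2 * m) - 1)) :
    IsGalois k⟮f⟯ (RatFunc k) ∧
    Nonempty ((RatFunc k ≃ₐ[k⟮f⟯] RatFunc k) ≃* DihedralGroup m) := by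
  have hm0 : m ≠ 0 := by
    rintro rfl
    simp at hm
  have hdeg : (Polynomial.X ^ (2 * m) - 1 : k[X]).natDegree = 2 * m :=
    natDegree_X_pow_sub_C (r := (1 : k))
  have hB : (Polynomial.X ^ (2 * m) - 1 : k[X]) ≠ 0 := by
    intro h
    rw [h, natDegree_zero] at hdeg
    omega
  have hcop : IsCoprime (Polynomial.X ^ m : k[X]) (Polynomial.X ^ (2 * m) - 1) :=
    ⟨Polynomial.X ^ m, -1, by ring⟩
  have hfr : Module.finrank k⟮f⟯ (RatFunc k) = 2 * m := by
    rw [hf, finrank_adjoin_div hcop hB, hdeg, natDegree_X_pow]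
    omega
  have hfin : FiniteDimensional k⟮f⟯ (RatFunc k) :=
    Module.finite_of_finrank_pos (by omega)
  obtain ⟨ζ, hζ⟩ := exists_isPrimitiveRoot_of_ne_zero hm
  -- With c^m = -1 the substitution X ↦ c/X sends X^m to -X^(-m) and X^(2m) to X^(-2m). The two
  -- signs cancel in f.
  obtain ⟨c, hc⟩ := IsAlgClosed.exists_pow_nat_eq (-1 : k) (Nat.pos_of_ne_zero hm0)
  have hζ0 : ζ ≠ 0 := hζ.ne_zero hm0
  have hc0 : c ≠ 0 := by
    rintro rfl
    rw [zero_pow hm0] at hc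
    exact one_ne_zero (neg_eq_zero.1 hc.symm)
  have hX0 : (X : RatFunc k) ≠ 0 := X_ne_zero
  have hexρ : ∃ σ : RatFunc k ≃ₐ[k⟮f⟯] RatFunc k, σ X = C ζ * (X - C 0) + C 0 := by
    subst hf
    refine exists_algEquiv_apply_X hB hfin ?_ ?_
    · refine ne_C_of_eval (p := Polynomial.C ζ * Polynomial.X) (q := 1)
        ?_ ?_ ?_
      · simp
      · rw [natDegree_C_mul_X _ hζ0]
        simp
      · simpa using hζ0
    · have hp : (C ζ : RatFunc k) ^ m = 1 := by rw [← map_pow, hζ.pow_eq_one, map_one]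
      simp only [map_zero, sub_zero, add_zero, map_one, map_sub, map_pow, aeval_X, algebraMap_X,
        mul_pow, pow_mul', hp, one_mul]
  have hexσ : ∃ σ : RatFunc k ≃ₐ[k⟮f⟯] RatFunc k, σ X = C c / X := by
    subst hf
    refine exists_algEquiv_apply_X hB hfin ?_ ?_
    · refine ne_C_of_eval (p := Polynomial.C c) (q := Polynomial.X)
        ?_ ?_ ?_
      · simp [hX0]
      · simp
      · simpa using hc0
    · have hp : (C c : RatFunc k) ^ m = -1 := by rw [← map_pow, hc, map_neg, map_one]
      simp only [map_one, map_sub, map_pow, aeval_X, algebraMap_X, div_pow, pow_mul', hp]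
      field_simp
      ring
  obtain ⟨ρ, hρ⟩ := hexρ
  obtain ⟨σ, hσ⟩ := hexσ
  have hord := orderOf_algEquiv hρ hζ
  have hρn := algEquiv_pow_apply_X hρ
  simp only [map_zero, sub_zero, add_zero] at hρ hρn
  have hC : ∀ (τ : RatFunc k ≃ₐ[k⟮f⟯] RatFunc k) (c : k), τ (C c) = C c := fun τ c =>
    (τ.restrictScalars k).commutes c
  have hCc : (C c : RatFunc k) ≠ 0 := (_root_.map_ne_zero C).2 hc0
  have hCζ : (C ζ : RatFunc k) ≠ 0 := (_root_.map_ne_zero C).2 hζ0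
  obtain ⟨hcard, hiso⟩ := exists_mulEquiv_dihedralGroup (ρ := ρ) (σ := σ) hm0 hord
    (by
      apply algEquiv_ext_of_apply_X
      rw [AlgEquiv.mul_apply, hσ, map_div₀, hC, hσ, AlgEquiv.one_apply]
      field_simp)
    (by
      rw [eq_inv_iff_mul_eq_one]
      apply algEquiv_ext_of_apply_X
      simp only [AlgEquiv.mul_apply, hρ, hσ, map_mul, map_div₀, hC, AlgEquiv.one_apply]
      field_simp)
    (by
      intro n h
      have h1 := hρn n
      rw [← h, hσ, div_eq_iff hX0] at h1
      have h2 : Polynomial.C c = Polynomial.C (ζ ^ n) * Polynomial.X ^ 2 := by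
        apply algebraMap_injective k
        simp only [map_mul, map_pow, algebraMap_C, algebraMap_X] at h1 ⊢
        rw [h1]
        ring
      have h3 := congrArg (fun p => p.coeff 0) h2
      simp at h3
      exact hc0 h3)
    (by
      rw [Nat.card_eq_fintype_card]
      exact AlgEquiv.card_le.trans hfr.le)
  exact ⟨IsGalois.of_card_aut_eq_finrank _ _ (hcard.trans hfr.symm), hiso⟩

end RatFunc

end

/-! ### Projections that are not Galois -/

section

open Polynomial IntermediateField algebraAdjoinAdjoin

section Trinomials

variable {k : Type*} [Field k]

theorem natDegree_X_pow_sub_smul (N : ℕ) (hN : 2 ≤ N) (c : k) :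
    (X ^ N - C c * (X - 1) : k[X]).natDegree = N := by
  have h : (C c * (X - 1) : k[X]).natDegree ≤ 1 := by compute_degree
  rw [natDegree_sub_eq_left_of_natDegree_lt] <;> rw [natDegree_X_pow]
  omega

theorem natDegree_X_pow_sub_X_sub_smul (N : ℕ) (hN : 2 ≤ N) (c : k) :
    (X ^ N - X - C c * (X - 1) : k[X]).natDegree = N := by
  have h : (X + C c * (X - 1) : k[X]).natDegree ≤ 1 := by compute_degree
  rw [sub_sub, natDegree_sub_eq_left_of_natDegree_lt] <;> rw [natDegree_X_pow]
  omega

/-- Modulo the divisor, X^(m+1) is l(X - 1). Multiplying the dividend by X therefore reduces it to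
degree at most 2 < m + 1, with constant term l² ≠ 0. -/
theorem not_trinomial_dvd {m : ℕ} (hm : 2 ≤ m) {l : k} (hl : l ≠ 0) (c : k) :
    ¬(X ^ (m + 1) - C l * (X - 1) : k[X]) ∣ X ^ (2 * m + 1) - X - C c * (X - 1) := by
  intro h
  set Q : k[X] := X ^ (m + 1) - C l * (X - 1) with hQ
  have h1 : Q ∣ (C l * (X - 1)) ^ 2 - X ^ 2 - C c * (X * (X - 1)) := by
    have h2 : (C l * (X - 1)) ^ 2 - X ^ 2 - C c * (X * (X - 1)) =
        X * (X ^ (2 * m + 1) - X - C c * (X - 1)) - Q * (X ^ (m + 1) + C l * (X - 1)) := by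
      rw [hQ]
      ring
    rw [h2]
    exact dvd_sub (h.mul_left _) (dvd_mul_right _ _)
  have hdeg : ((C l * (X - 1)) ^ 2 - X ^ 2 - C c * (X * (X - 1)) : k[X]).natDegree ≤ 2 := by
    compute_degree
  have h0 := eq_zero_of_dvd_of_natDegree_lt h1 (by
    rw [hQ, natDegree_X_pow_sub_smul _ (by omega)]
    omega)
  have := congrArg (eval 0) h0
  simp [hl] at this

/-- The second derivative is m(m+1)X^(m-1), so a triple root could only be 0, where the value is l.
-/
theorem not_X_sub_C_pow_three_dvd {m : ℕ} (hm : 2 ≤ m) (h0 : (m : k) ≠ 0) (h1 : (m : k) + 1 ≠ 0)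
    {l : k} (hl : l ≠ 0) (b : k) : ¬(X - C b) ^ 3 ∣ (X ^ (m + 1) - C l * (X - 1) : k[X]) := by
  rintro ⟨R, hR⟩
  have hb0 := congrArg (eval b) hR
  have hb2 := congrArg (fun p => eval b (derivative (derivative p))) hR
  simp [derivative_pow] at hb0 hb2
  have hm1 : m - 1 ≠ 0 := by omega
  simp [h0, h1, hm1] at hb2
  simp [hb2, hl] at hb0

theorem X_sub_C_sq_dvd {m : ℕ} {l b : k}
    (h : (X - C b) ^ 2 ∣ (X ^ (m + 1) - C l * (X - 1) : k[X])) :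
    b ^ (m + 1) = l * (b - 1) ∧ (m + 1) * b ^ m = l := by
  obtain ⟨R, hR⟩ := h
  have hb0 := congrArg (eval b) hR
  have hb1 := congrArg (fun p => eval b (derivative p)) hR
  simp [derivative_pow] at hb0 hb1
  exact ⟨sub_eq_zero.1 hb0, sub_eq_zero.1 hb1⟩

/-- The double root forces b = 4 and l = 3, and X³ - 3(X - 1) = (X - 4)²(X - 2) modulo 5. Thus a and
b both lie in the prime field, where x⁵ = x. -/
theorem eval_eq_zero_of_charP_five [CharP k 5] {a l b : k} (hl : l ≠ 0) (ha : a ^ 3 = l * (a - 1))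
    (h1 : b ^ 3 = l * (b - 1)) (h2 : ((2 : ℕ) + 1) * b ^ 2 = l) :
    b ^ 5 - b - (a ^ 5 - a) / (a - 1) * (b - 1) = 0 := by
  have h5 : (5 : k) = 0 := by exact_mod_cast CharP.cast_eq_zero k 5
  push_cast at h2
  have hb : b ≠ 0 := by
    rintro rfl
    apply hl
    rw [← h2]
    ring
  have hb4 : b = 4 := by
    have h3 : b ^ 2 * (2 * b - 3) = 0 := by
      rw [← h2] at h1
      linear_combination -h1
    have h4 := (mul_eq_zero.1 h3).resolve_left (pow_ne_zero 2 hb)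
    linear_combination 3 * h4 + (1 - b) * h5
  have hl3 : l = 3 := by
    rw [← h2, hb4]
    linear_combination 9 * h5
  have ha' : (a - 4) ^ 2 * (a - 2) = 0 := by
    rw [hl3] at ha
    linear_combination ha + (-2 * a ^ 2 + 7 * a - 7) * h5
  have hc : a ^ 5 - a = 0 := by
    rcases mul_eq_zero.1 ha' with h | h
    · have : a = 4 := sub_eq_zero.1 (eq_zero_of_pow_eq_zero h)
      rw [this]
      linear_combination 204 * h5
    · have : a = 2 := sub_eq_zero.1 h
      rw [this]
      linear_combination 6 * h5
  rw [hc, hb4]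
  linear_combination 204 * h5

end Trinomials

namespace RatFunc

variable {k : Type*} [Field k] [IsAlgClosed k]

theorem not_normal_adjoin_trinomials (p : ℕ) [CharP k p] (hp : p.Prime) {q n m : ℕ}
    (hq : q = p ^ n) (hqm : q = 2 * m + 1) (hm : 2 ≤ m) {a : k} (ha0 : a ≠ 0) (ha1 : a ≠ 1)
    {f : RatFunc k}
    (hf : f = algebraMap k[X] (RatFunc k) (Polynomial.X ^ (m + 1) -
        Polynomial.C (a ^ (m + 1) / (a - 1)) * (Polynomial.X - 1)) /
      algebraMap k[X] (RatFunc k) (Polynomial.X ^ q - Polynomial.X -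
        Polynomial.C ((a ^ q - a) / (a - 1)) * (Polynomial.X - 1))) :
    ¬Normal k⟮f⟯ (RatFunc k) := by
  classical
  intro hn
  have ha1' : a - 1 ≠ 0 := sub_ne_zero.2 ha1
  set l := a ^ (m + 1) / (a - 1) with hl
  set c := (a ^ q - a) / (a - 1) with hc
  have hl0 : l ≠ 0 := div_ne_zero (pow_ne_zero _ ha0) ha1'
  set Q₁ : k[X] := Polynomial.X ^ (m + 1) - Polynomial.C l * (Polynomial.X - 1) with hQ₁
  set Q₂ : k[X] := Polynomial.X ^ q - Polynomial.X - Polynomial.C c * (Polynomial.X - 1) with hQ₂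
  have hn0 : n ≠ 0 := by
    rintro rfl
    simp at hq
    omega
  have hq0 : ((2 * m + 1 : ℕ) : k) = 0 := by
    rw [← hqm, hq, Nat.cast_pow, CharP.cast_eq_zero, zero_pow hn0]
  push_cast at hq0
  have hm0 : (m : k) ≠ 0 := by
    intro h
    rw [h] at hq0
    simp at hq0
  have hm1 : (m : k) + 1 ≠ 0 := by
    intro h
    have : (1 : k) = 0 := by linear_combination 2 * h - hq0
    exact one_ne_zero this
  have hd₁ : Q₁.natDegree = m + 1 := natDegree_X_pow_sub_smul _ (by omega) _
  have hd₂ : Q₂.natDegree = q := natDegree_X_pow_sub_X_sub_smul _ (by omega) _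
  have hQ₁0 : Q₁ ≠ 0 := by
    intro h
    rw [h, natDegree_zero] at hd₁
    omega
  have hQ₂0 : Q₂ ≠ 0 := by
    intro h
    rw [h, natDegree_zero] at hd₂
    omega
  -- Both polynomials vanish at a, so the fraction is never in lowest terms. Dividing by the gcd
  -- leaves the difference of degrees equal to m.
  obtain ⟨A, hA⟩ := EuclideanDomain.gcd_dvd_left Q₁ Q₂
  obtain ⟨B, hB⟩ := EuclideanDomain.gcd_dvd_right Q₁ Q₂
  set D := EuclideanDomain.gcd Q₁ Q₂ with hD
  have hD0 : D ≠ 0 := by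
    intro h
    rw [h, zero_mul] at hA
    exact hQ₁0 hA
  have hA0 : A ≠ 0 := by
    rintro rfl
    rw [mul_zero] at hA
    exact hQ₁0 hA
  have hB0 : B ≠ 0 := by
    rintro rfl
    rw [mul_zero] at hB
    exact hQ₂0 hB
  have hcop : IsCoprime A B := by
    have h1 : D = _ := EuclideanDomain.gcd_eq_gcd_ab Q₁ Q₂
    refine ⟨EuclideanDomain.gcdA Q₁ Q₂, EuclideanDomain.gcdB Q₁ Q₂, mul_left_cancel₀ hD0 ?_⟩
    linear_combination -h1 + (-EuclideanDomain.gcdA Q₁ Q₂) * hA - EuclideanDomain.gcdB Q₁ Q₂ * hB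
  have hfAB : f = algebraMap k[X] (RatFunc k) A / algebraMap k[X] (RatFunc k) B := by
    rw [hf, hA, hB, map_mul, map_mul, mul_div_mul_left _ _ (algebraMap_ne_zero hD0)]
  have hdA : D.natDegree + A.natDegree = m + 1 := by
    rw [← natDegree_mul hD0 hA0, ← hA, hd₁]
  have hdB : D.natDegree + B.natDegree = q := by
    rw [← natDegree_mul hD0 hB0, ← hB, hd₂]
  have hApos : A.natDegree ≠ 0 := by
    intro h
    have hu : IsUnit A := isUnit_iff_degree_eq_zero.2 (by
      rw [degree_eq_natDegree hA0, h]
      rfl)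
    have : Q₁ ∣ Q₂ := by
      rw [hA, hB, hu.mul_right_dvd]
      exact dvd_mul_right _ _
    rw [hQ₂, hqm] at this
    exact not_trinomial_dvd hm hl0 _ this
  rw [hfAB] at hn
  obtain ⟨b, hb⟩ := exists_pow_dvd_of_normal hcop (by omega) hApos hn
  rw [show B.natDegree - A.natDegree = m by omega] at hb
  have hthree := not_X_sub_C_pow_three_dvd hm hm0 hm1 hl0 b
  have hAQ : A ∣ Q₁ := Dvd.intro_left _ hA.symm
  rcases Nat.lt_or_ge 2 m with h3 | h3
  · exact hthree ((pow_dvd_pow _ h3).trans (hb.trans hAQ))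
  -- Here q = 5. The double root b of A is also a root of `Q₂`; coprimality of A and B puts X - b
  -- into the gcd, so b is a triple root of `Q₁`.
  · have hm2 : m = 2 := le_antisymm h3 hm
    subst hm2
    have hp5 : p = 5 := by
      have h5 : q = 5 := hqm
      have : p ∣ 5 := by
        rw [← h5, hq]
        exact dvd_pow_self p hn0
      exact (Nat.prime_dvd_prime_iff_eq hp (by norm_num)).1 this
    subst hp5
    obtain ⟨hb0, hb1⟩ := X_sub_C_sq_dvd (hb.trans hAQ)
    have hroot : (Polynomial.X - Polynomial.C b) ∣ Q₂ := by
      rw [dvd_iff_isRoot, IsRoot.def, hQ₂, hc, hqm]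
      have := eval_eq_zero_of_charP_five (a := a) hl0 (by rw [hl]; field_simp) hb0 hb1
      simpa using this
    have hbA : (Polynomial.X - Polynomial.C b) ∣ A := (dvd_pow_self _ two_ne_zero).trans hb
    have hbB : IsCoprime (Polynomial.X - Polynomial.C b) B :=
      hcop.of_isCoprime_of_dvd_left hbA
    have hbD : (Polynomial.X - Polynomial.C b) ∣ D := by
      rw [hB] at hroot
      exact hbB.dvd_of_dvd_mul_right hroot
    apply hthree
    rw [← hQ₁, hA, pow_succ']
    exact mul_dvd_mul hbD hb

/-- The function vanishes to order m at infinity, but its only finite zero, at 1, is simple. -/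
theorem not_normal_adjoin_linear_div_pow {m : ℕ} (hm : 2 ≤ m) {f : RatFunc k}
    (hf : f = algebraMap k[X] (RatFunc k) (Polynomial.X - 1) /
      algebraMap k[X] (RatFunc k) (Polynomial.X ^ (m + 1))) :
    ¬Normal k⟮f⟯ (RatFunc k) := by
  intro hn
  rw [hf] at hn
  have hd : (Polynomial.X - 1 : k[X]).natDegree = 1 := natDegree_X_sub_C 1
  have hcop : IsCoprime (Polynomial.X - 1 : k[X]) (Polynomial.X ^ (m + 1)) :=
    (show IsCoprime (Polynomial.X - 1 : k[X]) Polynomial.X from ⟨-1, 1, by ring⟩).pow_right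
  obtain ⟨b, hb⟩ := exists_pow_dvd_of_normal hcop (by rw [hd, natDegree_X_pow]; omega)
    (by rw [hd]; exact one_ne_zero) hn
  have h0 : (Polynomial.X - 1 : k[X]) ≠ 0 := by
    intro h
    rw [h, natDegree_zero] at hd
    omega
  have := natDegree_le_of_dvd hb h0
  rw [hd, natDegree_pow, natDegree_X_sub_C, natDegree_X_pow] at this
  omega

end RatFunc

end

/-! ### The equation of the curve by elimination -/

noncomputable section

section BinomPow

variable {R S : Type*} [CommRing R] [CommRing S]

/-- The coefficients `(c, d)` of `(w - y) ^ n = c + d * w` modulo `w ^ 2 + z * w - x ^ 2`. -/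
def binomPow (x y z : R) : ℕ → R × R
  | 0 => (1, 0)
  | n + 1 => (x ^ 2 * (binomPow x y z n).2 - y * (binomPow x y z n).1,
      (binomPow x y z n).1 - (z + y) * (binomPow x y z n).2)

theorem binomPow_spec {x y z w : R} (hw : w ^ 2 + z * w = x ^ 2) (n : ℕ) :
    (w - y) ^ n = (binomPow x y z n).1 + (binomPow x y z n).2 * w := by
  induction n with
  | zero => simp [binomPow]
  | succ n ih =>
    rw [pow_succ, ih]
    simp only [binomPow]
    linear_combination (binomPow x y z n).2 * hw

theorem map_binomPow (f : R →+* S) (x y z : R) (n : ℕ) :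
    binomPow (f x) (f y) (f z) n = (f (binomPow x y z n).1, f (binomPow x y z n).2) := by
  induction n with
  | zero => simp [binomPow]
  | succ n ih => simp [binomPow, ih]

theorem binomPow_norm (x y z : R) (n : ℕ) :
    (binomPow x y z n).1 ^ 2 - (binomPow x y z n).1 * (binomPow x y z n).2 * z -
      (binomPow x y z n).2 ^ 2 * x ^ 2 = (y ^ 2 + y * z - x ^ 2) ^ n := by
  induction n with
  | zero => simp [binomPow]
  | succ n ih =>
    rw [pow_succ _ n, ← ih]
    simp only [binomPow]
    ring

theorem binomPow_zero_fst (y z : R) (n : ℕ) : (binomPow 0 y z n).1 = (-y) ^ n := by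
  induction n with
  | zero => simp [binomPow]
  | succ n ih =>
    simp only [binomPow, ih]
    ring

theorem binomPow_zero_zero_snd (z : R) (n : ℕ) :
    (binomPow 0 0 z (n + 1)).2 = (-z) ^ n := by
  induction n with
  | zero => simp [binomPow]
  | succ n ih =>
    rw [binomPow, ih, binomPow_zero_fst]
    ring

/-- `w ^ (m + 1) - x * (w - y) ^ m = x * constCoeff + linCoeff * w` modulo
`w ^ 2 + z * w - x ^ 2`. -/
def constCoeff (m : ℕ) (x y z : R) : R :=
  x * (binomPow x 0 z m).2 - (binomPow x y z m).1

/-- The coefficient of `w` in the reduction of `w ^ (m + 1) - x * (w - y) ^ m` modulo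
`w ^ 2 + z * w - x ^ 2`. -/
def linCoeff (m : ℕ) (x y z : R) : R :=
  (binomPow x 0 z (m + 1)).2 - x * (binomPow x y z m).2

theorem constCoeff_add_linCoeff {m : ℕ} {x y z w : R} (hw : w ^ 2 + z * w = x ^ 2) :
    x * constCoeff m x y z + linCoeff m x y z * w = w ^ (m + 1) - x * (w - y) ^ m := by
  have h1 := binomPow_spec (y := 0) hw (m + 1)
  rw [sub_zero] at h1
  rw [h1, binomPow_spec hw m]
  simp only [constCoeff, linCoeff, binomPow]
  ring

/-- The equation of the curve: the norm of `x * constCoeff + linCoeff * w`, divided by `x`. -/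
def curveEq (m : ℕ) (x y z : R) : R :=
  x * constCoeff m x y z ^ 2 - constCoeff m x y z * linCoeff m x y z * z -
    x * linCoeff m x y z ^ 2

theorem map_constCoeff (f : R →+* S) (m : ℕ) (x y z : R) :
    f (constCoeff m x y z) = constCoeff m (f x) (f y) (f z) := by
  have h := map_binomPow f x 0 z m
  rw [map_zero] at h
  simp [constCoeff, map_binomPow f x y z, h]

theorem map_linCoeff (f : R →+* S) (m : ℕ) (x y z : R) :
    f (linCoeff m x y z) = linCoeff m (f x) (f y) (f z) := by
  have h := map_binomPow f x 0 z (m + 1)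
  rw [map_zero] at h
  simp [linCoeff, map_binomPow f x y z, h]

theorem map_curveEq (f : R →+* S) (m : ℕ) (x y z : R) :
    f (curveEq m x y z) = curveEq m (f x) (f y) (f z) := by
  simp [curveEq, map_constCoeff f, map_linCoeff f]

/-- For y = 0 one takes the norm of w^m(w - x). Here w has norm -x² and w - x has norm xz. -/
theorem curveEq_middle_zero (m : ℕ) (x z : R) : curveEq m x 0 z = z * (-x ^ 2) ^ m := by
  have h := binomPow_norm x 0 z m
  rw [show (0 : R) ^ 2 + 0 * z - x ^ 2 = -x ^ 2 by ring] at h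
  rw [← h]
  simp only [curveEq, constCoeff, linCoeff, binomPow]
  ring

theorem curveEq_zero (m : ℕ) (y z : R) : curveEq m 0 y z = (-y) ^ m * (-z) ^ m * z := by
  simp only [curveEq, constCoeff, linCoeff, binomPow_zero_zero_snd, binomPow_zero_fst]
  ring

/-- The second factor comes from the conjugate root -z - w of the quadratic equation. -/
theorem curveEq_mul {m : ℕ} {x y z w : R} (hw : w ^ 2 + z * w = x ^ 2) :
    x * curveEq m x y z = (x * constCoeff m x y z + linCoeff m x y z * w) *
      (x * constCoeff m x y z + linCoeff m x y z * (-z - w)) := by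
  simp only [curveEq]
  linear_combination (linCoeff m x y z ^ 2) * hw

end BinomPow

section Homogeneous

open MvPolynomial

variable {k σ : Type*} [CommRing k]

theorem isHomogeneous_binomPow {x y z : MvPolynomial σ k} (hx : x.IsHomogeneous 1)
    (hy : y.IsHomogeneous 1) (hz : z.IsHomogeneous 1) (n : ℕ) :
    (binomPow x y z n).1.IsHomogeneous n ∧ (x * (binomPow x y z n).2).IsHomogeneous n ∧
      (binomPow x y z (n + 1)).2.IsHomogeneous n := by
  induction n with
  | zero =>
    simp [binomPow, isHomogeneous_one, isHomogeneous_zero]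
  | succ n ih =>
    obtain ⟨h1, h2, h3⟩ := ih
    have h4 : (binomPow x y z (n + 1)).1.IsHomogeneous (n + 1) := by
      rw [binomPow, pow_two, mul_assoc, add_comm n 1]
      exact (hx.mul h2).sub (hy.mul h1)
    refine ⟨h4, ?_, ?_⟩
    · rw [add_comm n 1]
      have := hx.mul h3
      rwa [add_comm n 1] at this
    · rw [binomPow]
      refine h4.sub ?_
      have := (hz.add hy).mul h3
      rwa [add_comm 1 n] at this

theorem isHomogeneous_constCoeff {x y z : MvPolynomial σ k} (hx : x.IsHomogeneous 1)
    (hy : y.IsHomogeneous 1) (hz : z.IsHomogeneous 1) (m : ℕ) :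
    (constCoeff m x y z).IsHomogeneous m :=
  (isHomogeneous_binomPow hx (isHomogeneous_zero _ _ _) hz m).2.1.sub
    (isHomogeneous_binomPow hx hy hz m).1

theorem isHomogeneous_linCoeff {x y z : MvPolynomial σ k} (hx : x.IsHomogeneous 1)
    (hy : y.IsHomogeneous 1) (hz : z.IsHomogeneous 1) (m : ℕ) :
    (linCoeff m x y z).IsHomogeneous m :=
  (isHomogeneous_binomPow hx (isHomogeneous_zero _ _ _) hz m).2.2.sub
    (isHomogeneous_binomPow hx hy hz m).2.1

theorem isHomogeneous_curveEq {x y z : MvPolynomial σ k} (hx : x.IsHomogeneous 1)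
    (hy : y.IsHomogeneous 1) (hz : z.IsHomogeneous 1) (m : ℕ) :
    (curveEq m x y z).IsHomogeneous (2 * m + 1) := by
  have h1 := isHomogeneous_constCoeff hx hy hz m
  have h2 := isHomogeneous_linCoeff hx hy hz m
  refine (IsHomogeneous.sub ?_ ?_).sub ?_
  · convert hx.mul (h1.pow 2) using 1
    ring
  · convert (h1.mul h2).mul hz using 1
    ring
  · convert hx.mul (h2.pow 2) using 1
    ring

end Homogeneous

theorem phiVec_odd {k : Type*} [Field k] {q m : ℕ} (hq : q = 2 * m + 1) (s t : k) :
    phiVec q ![s, t] = ![s ^ (m + 1) * t ^ m, (s - t) * t ^ (2 * m),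
      s ^ (2 * m + 1) - s * t ^ (2 * m)] := by
  subst hq
  have e1 : (2 * m + 1 + 1) / 2 = m + 1 := by omega
  have e2 : (2 * m + 1 - 1) / 2 = m := by omega
  have e3 : 2 * m + 1 - 1 = 2 * m := by omega
  simp [phiVec, e1]

theorem curveEq_phi {R : Type*} [CommRing R] [IsDomain R] {m : ℕ} (hm : m ≠ 0) (s t : R) :
    curveEq m (s ^ (m + 1) * t ^ m) ((s - t) * t ^ (2 * m))
      (s ^ (2 * m + 1) - s * t ^ (2 * m)) = 0 := by
  by_cases h0 : s ^ (m + 1) * t ^ m = 0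
  · rw [h0, curveEq_zero]
    rcases mul_eq_zero.1 h0 with h | h
    · have hs := eq_zero_of_pow_eq_zero h
      simp [hs]
    · have ht := eq_zero_of_pow_eq_zero h
      simp [ht, hm]
  -- The common root of the two equations is w = s t^(2m), for which w - y = t^(2m+1).
  · have hw : (s * t ^ (2 * m)) ^ 2 + (s ^ (2 * m + 1) - s * t ^ (2 * m)) * (s * t ^ (2 * m)) =
        (s ^ (m + 1) * t ^ m) ^ 2 := by ring
    have h1 := curveEq_mul (m := m) (y := (s - t) * t ^ (2 * m)) hw
    rw [constCoeff_add_linCoeff hw] at h1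
    refine (mul_eq_zero.1 (h1.trans ?_)).resolve_left h0
    have : (s * t ^ (2 * m)) ^ (m + 1) - s ^ (m + 1) * t ^ m *
        (s * t ^ (2 * m) - (s - t) * t ^ (2 * m)) ^ m = 0 := by
      have h2 : s * t ^ (2 * m) - (s - t) * t ^ (2 * m) = t ^ (2 * m + 1) := by ring
      rw [h2]
      ring
    rw [this, zero_mul]

theorem exists_phi_of_curveEq {k : Type*} [Field k] [IsAlgClosed k] {m : ℕ} (hm : m ≠ 0)
    {x y z : k} (h : curveEq m x y z = 0) :
    ∃ s t : k, x = s ^ (m + 1) * t ^ m ∧ y = (s - t) * t ^ (2 * m) ∧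
      z = s ^ (2 * m + 1) - s * t ^ (2 * m) := by
  have hroot : ∀ a : k, ∃ b, b ^ (2 * m + 1) = a := fun a =>
    IsAlgClosed.exists_pow_nat_eq a (Nat.succ_pos _)
  by_cases hx : x = 0
  · subst hx
    rw [curveEq_zero] at h
    by_cases hy : y = 0
    · obtain ⟨s, hs⟩ := hroot z
      exact ⟨s, 0, by simp [hm], by simp [hy, hm], by simp [hm, hs]⟩
    · have hz : z = 0 := by
        simpa [hy, hm] using h
      obtain ⟨t, ht⟩ := hroot (-y)
      refine ⟨0, t, by simp, ?_, by simp [hz]⟩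
      linear_combination ht
  -- A vanishing norm means that one of the two conjugate roots satisfies the second equation.
  · have hex : ∃ w : k, w ^ 2 + z * w = x ^ 2 ∧ w ^ (m + 1) = x * (w - y) ^ m := by
      obtain ⟨w, hw⟩ := IsAlgClosed.exists_root
        (Polynomial.X ^ 2 + Polynomial.C z * Polynomial.X + Polynomial.C (-x ^ 2) :
          Polynomial k) (by
        have : (Polynomial.X ^ 2 + Polynomial.C z * Polynomial.X + Polynomial.C (-x ^ 2) :
          Polynomial k).degree = 2 := by compute_degree!
        rw [this]
        decide)
      have hw' : w ^ 2 + z * w = x ^ 2 := by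
        simp at hw
        linear_combination hw
      have hw2 : (-z - w) ^ 2 + z * (-z - w) = x ^ 2 := by
        linear_combination hw'
      have h1 := curveEq_mul (m := m) (y := y) hw'
      rw [h, mul_zero, constCoeff_add_linCoeff hw', constCoeff_add_linCoeff hw2] at h1
      rcases mul_eq_zero.1 h1.symm with h2 | h2
      · exact ⟨w, hw', sub_eq_zero.1 h2⟩
      · exact ⟨_, hw2, sub_eq_zero.1 h2⟩
    obtain ⟨w, hw, hw'⟩ := hex
    have hw0 : w ≠ 0 := by
      rintro rfl
      apply hx
      simpa using hw.symm
    -- The parameters are recovered from w - y = t^(2m+1) and w = s t^(2m).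
    obtain ⟨t, ht⟩ := hroot (w - y)
    have ht0 : t ≠ 0 := by
      rintro rfl
      rw [zero_pow (by omega)] at ht
      rw [← ht, zero_pow hm, mul_zero] at hw'
      exact hw0 (eq_zero_of_pow_eq_zero hw')
    have hs : w / t ^ (2 * m) * t ^ (2 * m) = w := div_mul_cancel₀ _ (pow_ne_zero _ ht0)
    generalize w / t ^ (2 * m) = s at hs
    have hxe : x = s ^ (m + 1) * t ^ m := by
      rw [← ht, ← hs] at hw'
      have h3 : (t ^ (2 * m + 1)) ^ m ≠ 0 := pow_ne_zero _ (pow_ne_zero _ ht0)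
      apply mul_right_cancel₀ h3
      rw [← hw']
      ring
    refine ⟨s, t, hxe, ?_, ?_⟩
    · linear_combination ht - hs
    · apply mul_right_cancel₀ hw0
      rw [hxe] at hw
      rw [← hs] at hw ⊢
      linear_combination hw

/-- This nonvanishing lets w, and hence s, be solved for rationally, which gives birationality.
Otherwise the conjugate root -s^(2m+1) would also satisfy the second equation; cancelling s^(m+1)
and setting s = 0 gives a contradiction. -/
theorem linCoeff_phi_ne_zero {k : Type*} [Field k] {m : ℕ} (hm : m ≠ 0) :
    linCoeff m (Polynomial.X ^ (m + 1) : Polynomial k) (Polynomial.X - 1)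
      (Polynomial.X ^ (2 * m + 1) - Polynomial.X) ≠ 0 := by
  intro h
  set s : Polynomial k := Polynomial.X with hs
  have hw : s ^ 2 + (s ^ (2 * m + 1) - s) * s = (s ^ (m + 1)) ^ 2 := by ring
  have hw2 : (-s ^ (2 * m + 1)) ^ 2 + (s ^ (2 * m + 1) - s) * (-s ^ (2 * m + 1)) =
    (s ^ (m + 1)) ^ 2 := by ring
  have h1 := constCoeff_add_linCoeff (m := m) (y := s - 1) hw
  have h2 := constCoeff_add_linCoeff (m := m) (y := s - 1) hw2
  rw [h, zero_mul, add_zero] at h1 h2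
  rw [h1, sub_sub_cancel, one_pow, mul_one, sub_self] at h2
  have h3 : s ^ (m + 1) * ((-s ^ (2 * m)) ^ (m + 1) - (-s ^ (2 * m + 1) - (s - 1)) ^ m) = 0 := by
    rw [mul_sub, ← mul_pow, h2]
    ring
  have h4 := (mul_eq_zero.1 h3).resolve_left (pow_ne_zero _ Polynomial.X_ne_zero)
  have h5 := congrArg (Polynomial.eval 0) h4
  simp [hs, hm] at h5

section Derivative

open MvPolynomial

/-- The chain rule along a parametrized curve; along an affine coordinate line it isolates a single
partial derivative. -/
theorem MvPolynomial.derivative_aeval {k σ : Type*} [CommRing k] [Fintype σ]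
    (f : σ → Polynomial k) (H : MvPolynomial σ k) :
    Polynomial.derivative (aeval f H) =
      ∑ i, aeval f (pderiv i H) * Polynomial.derivative (f i) := by
  classical
  induction H using MvPolynomial.induction_on with
  | C a => simp [MvPolynomial.algHom_C]
  | add p q hp hq => simp [hp, hq, add_mul, Finset.sum_add_distrib]
  | mul_X p i hp =>
    have h : ∀ j, aeval f (pderiv j (p * X i)) * Polynomial.derivative (f j) =
        aeval f (pderiv j p) * Polynomial.derivative (f j) * f i +
          if j = i then aeval f p * Polynomial.derivative (f i) else 0 := by
      intro j
      rw [pderiv_mul, map_add, map_mul, map_mul, aeval_X]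
      split_ifs with hj
      · subst hj
        rw [pderiv_X_self, map_one]
        ring
      · rw [pderiv_X_of_ne (Ne.symm hj), map_zero]
        ring
    rw [Finset.sum_congr rfl fun j _ => h j, Finset.sum_add_distrib, ← Finset.sum_mul, ← hp,
      Finset.sum_ite_eq' Finset.univ i, if_pos (Finset.mem_univ i), map_mul, aeval_X,
      Polynomial.derivative_mul]

end Derivative

end

/-! ### Forms vanishing on the parametrized curve -/

noncomputable section

namespace MvPolynomial

variable {k σ A : Type*} [CommRing k] [CommRing A] [Algebra k A]

theorem IsHomogeneous.aeval_mul {H : MvPolynomial σ k} {n : ℕ} (hH : H.IsHomogeneous n) (c : A)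
    (f : σ → A) : MvPolynomial.aeval (fun i => c * f i) H = c ^ n * MvPolynomial.aeval f H := by
  rw [aeval_def, aeval_def, eval₂_eq, eval₂_eq, Finset.mul_sum]
  refine Finset.sum_congr rfl fun d hd => ?_
  have hdeg := hH (mem_support_iff.1 hd)
  rw [Finsupp.weight_apply, Finsupp.sum] at hdeg
  simp only [Pi.one_apply, smul_eq_mul, mul_one] at hdeg
  simp only [mul_pow]
  rw [Finset.prod_mul_distrib, Finset.prod_pow_eq_pow_sum, hdeg]
  ring

/-- The substitution `X i ↦ f i * T`, which sorts a polynomial by degree. -/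
def gradedEval (f : σ → A) : MvPolynomial σ k →ₐ[k] Polynomial A :=
  MvPolynomial.aeval fun i => Polynomial.X * Polynomial.C (f i)

theorem gradedEval_of_isHomogeneous (f : σ → A) {H : MvPolynomial σ k} {n : ℕ}
    (hH : H.IsHomogeneous n) :
    gradedEval f H = Polynomial.C (MvPolynomial.aeval f H) * Polynomial.X ^ n := by
  rw [gradedEval, hH.aeval_mul, mul_comm]
  congr 1
  have := MvPolynomial.comp_aeval_apply (R := k) f
    (IsScalarTower.toAlgHom k A (Polynomial A)) H
  exact this.symm

theorem coeff_gradedEval (f : σ → A) (H : MvPolynomial σ k) (d : ℕ) :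
    (gradedEval f H).coeff d = MvPolynomial.aeval f (homogeneousComponent d H) := by
  conv_lhs => rw [← sum_homogeneousComponent H, map_sum]
  rw [Polynomial.finsetSum_coeff]
  simp only [gradedEval_of_isHomogeneous f (homogeneousComponent_isHomogeneous _ H),
    Polynomial.coeff_C_mul_X_pow]
  rw [Finset.sum_ite_eq]
  split_ifs with h
  · rfl
  · rw [homogeneousComponent_eq_zero, map_zero]
    simpa [Nat.lt_succ_iff] using h

theorem exists_isHomogeneous_of_dvd {k : Type*} [Field k] {F G : MvPolynomial σ k} {n : ℕ}
    (hG : G.IsHomogeneous n) (hG0 : G ≠ 0) (h : F ∣ G) : ∃ d, F.IsHomogeneous d := by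
  obtain ⟨H, rfl⟩ := h
  set ψ := gradedEval (k := k) (X : σ → MvPolynomial σ k) with hψ
  have hinj : ∀ P, P ≠ 0 → ψ P ≠ 0 := by
    intro P hP h0
    apply hP
    rw [← sum_homogeneousComponent P]
    refine Finset.sum_eq_zero fun i _ => ?_
    have := coeff_gradedEval (k := k) (X : σ → MvPolynomial σ k) P i
    rw [← hψ, h0, Polynomial.coeff_zero] at this
    simpa using this.symm
  have hF := hinj F (left_ne_zero_of_mul hG0)
  have hH := hinj H (right_ne_zero_of_mul hG0)
  have hmul : ψ F * ψ H = Polynomial.C (F * H) * Polynomial.X ^ n := by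
    rw [← map_mul, hψ, gradedEval_of_isHomogeneous _ hG]
    simp
  -- Highest and lowest degrees both add up to n over the two factors, so within each factor they
  -- coincide.
  have h1 := congrArg Polynomial.natDegree hmul
  have h2 := congrArg Polynomial.natTrailingDegree hmul
  rw [Polynomial.natDegree_mul hF hH, Polynomial.natDegree_C_mul_X_pow _ _ hG0] at h1
  rw [Polynomial.natTrailingDegree_mul hF hH, Polynomial.C_mul_X_pow_eq_monomial,
    Polynomial.natTrailingDegree_monomial hG0] at h2
  have h3 := Polynomial.natTrailingDegree_le_natDegree (ψ F)
  have h4 := Polynomial.natTrailingDegree_le_natDegree (ψ H)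
  refine ⟨(ψ F).natDegree, ?_⟩
  have hcomp : ∀ i, i ≠ (ψ F).natDegree → homogeneousComponent i F = 0 := by
    intro i hi
    have := coeff_gradedEval (k := k) (X : σ → MvPolynomial σ k) F i
    rw [aeval_X_left_apply, ← hψ] at this
    rw [← this]
    rcases lt_or_gt_of_ne hi with h | h
    · exact Polynomial.coeff_eq_zero_of_lt_natTrailingDegree (by omega)
    · exact Polynomial.coeff_eq_zero_of_natDegree_lt h
  have hsum := sum_homogeneousComponent F
  rw [Finset.sum_eq_single (ψ F).natDegree (fun i _ hi => hcomp i hi)] at hsum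
  · have := homogeneousComponent_isHomogeneous (ψ F).natDegree F
    rwa [hsum] at this
  · intro h
    rw [Finset.mem_range, Nat.lt_succ_iff, not_le] at h
    exact homogeneousComponent_eq_zero (ψ F).natDegree F h

end MvPolynomial

open MvPolynomial

namespace PlaneCurve

variable {k : Type*} [Field k]

theorem eval_smul_of_isHomogeneous {H : MvPolynomial (Fin 3) k} {n : ℕ} (hH : H.IsHomogeneous n)
    (c : k) (v : Fin 3 → k) : eval (c • v) H = c ^ n * eval v H := by
  have := hH.aeval_mul c v
  rwa [← coe_aeval_eq_eval]

theorem eval_rep_mk {H : MvPolynomial (Fin 3) k} {n : ℕ} (hH : H.IsHomogeneous n)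
    (v : Fin 3 → k) (hv : v ≠ 0) :
    eval (Projectivization.mk k v hv).rep H = 0 ↔ eval v H = 0 := by
  obtain ⟨a, ha⟩ := Projectivization.exists_smul_eq_mk_rep k v hv
  rw [← ha, Units.smul_def, eval_smul_of_isHomogeneous hH]
  simp

theorem mk_mem_points (C : PlaneCurve k) (v : Fin 3 → k) (hv : v ≠ 0) :
    Projectivization.mk k v hv ∈ C.points ↔ eval v C.form = 0 :=
  eval_rep_mk C.isHomogeneous v hv

theorem eval_aeval_polynomial (f : Fin 3 → Polynomial k) (H : MvPolynomial (Fin 3) k) (s : k) :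
    Polynomial.eval s (aeval f H) = eval (fun i => (f i).eval s) H := by
  have := comp_aeval_apply (R := k) f (Polynomial.aeval s) H
  simpa only [Polynomial.coe_aeval_eq_eval, coe_aeval_eq_eval, aeval_eq_eval] using this

/-- The affine chart `s ↦ φ₁(s : 1)`. -/
def chart (k : Type*) [Field k] (m : ℕ) : Fin 3 → Polynomial k :=
  ![Polynomial.X ^ (m + 1), Polynomial.X - 1, Polynomial.X ^ (2 * m + 1) - Polynomial.X]

theorem eval_aeval_chart {q m : ℕ} (hq : q = 2 * m + 1) (H : MvPolynomial (Fin 3) k) (s : k) :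
    Polynomial.eval s (aeval (chart k m) H) = eval (phiVec q ![s, 1]) H := by
  rw [eval_aeval_polynomial, phiVec_odd hq]
  congr 2
  funext i
  fin_cases i <;> simp [chart]

theorem phi_mk {q : ℕ} (hq : Odd q) (v : Fin 2 → k) (hv : v ≠ 0) :
    phi q hq (Projectivization.mk k v hv) =
      Projectivization.mk k (phiVec q v) (phiVec_ne_zero hq hv) := rfl

variable {q m : ℕ} {hodd : Odd q} {C : PlaneCurve k}

theorem eval_phiVec (hC : C.points = Set.range (phi q hodd)) (v : Fin 2 → k) (hv : v ≠ 0) :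
    eval (phiVec q v) C.form = 0 := by
  rw [← mk_mem_points C _ (phiVec_ne_zero hodd hv), hC]
  exact ⟨_, phi_mk hodd v hv⟩

theorem aeval_chart_form [Infinite k] (hq : q = 2 * m + 1) (hC : C.points = Set.range (phi q hodd)) :
    aeval (chart k m) C.form = 0 := by
  apply Polynomial.funext
  intro s
  rw [eval_aeval_chart hq, Polynomial.eval_zero]
  exact eval_phiVec hC _ (by simp)

variable [IsAlgClosed k]

theorem eval_phiVec_of_aeval_chart (hodd : Odd q) (hq : q = 2 * m + 1) (hm : m ≠ 0)
    {H : MvPolynomial (Fin 3) k} {n : ℕ} (hH : H.IsHomogeneous n)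
    (h0 : aeval (chart k m) H = 0) : ∀ v, v ≠ 0 → eval (phiVec q v) H = 0 := by
  have hs : ∀ s, eval (phiVec q ![s, 1]) H = 0 := fun s => by
    rw [← eval_aeval_chart hq, h0, Polynomial.eval_zero]
  have hst : ∀ s t, t ≠ 0 → eval (phiVec q ![s, t]) H = 0 := fun s t ht => by
    have : (![s, t] : Fin 2 → k) = t • ![s / t, 1] := by
      funext i
      fin_cases i <;> simp [mul_div_cancel₀ _ ht]
    rw [this, phiVec_smul hodd, eval_smul_of_isHomogeneous hH, hs, mul_zero]
  -- φ₁(1 : 0) lies outside the chart. Along φ₁(1 : t), H is a polynomial in t that vanishes for t ≠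
  -- 0, hence also at t = 0.
  have hinf : eval ![0, 0, 1] H = 0 := by
    have hP : aeval (![Polynomial.X ^ m, (1 - Polynomial.X) * Polynomial.X ^ (2 * m),
        1 - Polynomial.X ^ (2 * m)] : Fin 3 → Polynomial k) H = 0 := by
      apply Polynomial.eq_zero_of_infinite_isRoot
      refine Set.Infinite.mono (s := {0}ᶜ) ?_ (Set.finite_singleton _).infinite_compl
      intro t ht
      rw [Set.mem_ofPred_eq, Polynomial.IsRoot.def, ← hst 1 t ht, eval_aeval_polynomial, phiVec_odd hq]
      congr 2
      funext i
      fin_cases i <;> simp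
    have := congrArg (Polynomial.eval 0) hP
    rw [Polynomial.eval_zero, eval_aeval_polynomial] at this
    convert this using 2
    congr 1
    funext i
    fin_cases i <;> simp [hm]
  intro v hv
  have hv' : v = ![v 0, v 1] := by
    funext i
    fin_cases i <;> rfl
  by_cases h1 : v 1 = 0
  · have h3 : phiVec q v = (v 0) ^ q • ![0, 0, 1] := by
      rw [hv', h1, phiVec_odd hq]
      funext i
      fin_cases i <;> simp [hm, hq]
    rw [h3, eval_smul_of_isHomogeneous hH, hinf, mul_zero]
  · rw [hv']
    exact hst _ _ h1

/-- By the Nullstellensatz: H vanishes on the affine cone over the curve, and the ideal of the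
irreducible form is prime. -/
theorem form_dvd_of_aeval_chart (hq : q = 2 * m + 1) (hm : m ≠ 0)
    (hC : C.points = Set.range (phi q hodd))
    {H : MvPolynomial (Fin 3) k} {n : ℕ} (hH : H.IsHomogeneous n)
    (h0 : aeval (chart k m) H = 0) : C.form ∣ H := by
  have hall := eval_phiVec_of_aeval_chart hodd hq hm hH h0
  have hmem : H ∈ vanishingIdeal k (zeroLocus k (Ideal.span {C.form})) := by
    rw [mem_vanishingIdeal_iff]
    intro x hx
    rw [mem_zeroLocus_iff] at hx
    have hx0 := hx C.form (Ideal.mem_span_singleton_self _)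
    rw [aeval_eq_eval] at hx0 ⊢
    by_cases hx1 : x = 0
    · have h2 := eval_smul_of_isHomogeneous hH 0 (phiVec q ![0, 1])
      rw [hall _ (by simp), mul_zero, zero_smul] at h2
      rw [hx1]
      exact h2
    · have h3 := (mk_mem_points C x hx1).2 hx0
      rw [hC] at h3
      obtain ⟨P, hP⟩ := h3
      induction P using Projectivization.ind with
      | h v hv =>
        rw [phi_mk, Projectivization.mk_eq_mk_iff'] at hP
        obtain ⟨a, ha⟩ := hP
        have h4 := hall v hv
        rw [← ha, eval_smul_of_isHomogeneous hH] at h4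
        refine (mul_eq_zero.1 h4).resolve_left (pow_ne_zero _ ?_)
        rintro rfl
        rw [zero_smul] at ha
        exact phiVec_ne_zero hodd hv ha.symm
  rw [IsPrime.vanishingIdeal_zeroLocus] at hmem
  exact Ideal.mem_span_singleton.1 hmem

theorem aeval_chart_eq_zero_iff (hq : q = 2 * m + 1) (hm : m ≠ 0)
    (hC : C.points = Set.range (phi q hodd))
    {H : MvPolynomial (Fin 3) k} {n : ℕ} (hH : H.IsHomogeneous n) :
    aeval (chart k m) H = 0 ↔ C.form ∣ H := by
  refine ⟨form_dvd_of_aeval_chart hq hm hC hH, ?_⟩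
  rintro ⟨Q, rfl⟩
  rw [map_mul, aeval_chart_form hq hC, zero_mul]

end PlaneCurve

end

/-! ### The function field as a field of rational functions -/

noncomputable section

open MvPolynomial

namespace PlaneCurve

variable {k : Type*} [Field k]

theorem toConeField_eq (C : PlaneCurve k) (H : MvPolynomial (Fin 3) k) :
    C.toConeField H =
      algebraMap C.CoordRing C.ConeField (Ideal.Quotient.mk (Ideal.span {C.form}) H) := rfl

theorem toConeField_eq_zero_iff (C : PlaneCurve k) (H : MvPolynomial (Fin 3) k) :
    C.toConeField H = 0 ↔ C.form ∣ H := by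
  rw [toConeField_eq, FaithfulSMul.algebraMap_eq_zero_iff, Ideal.Quotient.eq_zero_iff_mem,
    Ideal.mem_span_singleton]

variable (C : PlaneCurve k)

/-- Sending each variable to f i times a new variable T keeps degrees apart, so the kernel is
generated by the form and the map extends to the cone field. In a quotient of forms of equal degree
the powers of T cancel, so the value lies in `RatFunc k`. -/
theorem exists_functionField_algHom (f : Fin 3 → RatFunc k)
    (hf : ∀ (H : MvPolynomial (Fin 3) k) (n : ℕ), H.IsHomogeneous n →
      (aeval f H = 0 ↔ C.form ∣ H)) :
    ∃ e : C.functionField →ₐ[k] RatFunc k, ∀ (x : C.functionField) (d : ℕ)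
      (a b : MvPolynomial (Fin 3) k), a.IsHomogeneous d → b.IsHomogeneous d →
      (x : C.ConeField) = C.toConeField a / C.toConeField b →
      e x = aeval f a / aeval f b := by
  let D := Polynomial (RatFunc k)
  have hker : ∀ H, gradedEval f H = 0 ↔ C.form ∣ H := by
    intro H
    constructor
    · intro h
      rw [← sum_homogeneousComponent H]
      refine Finset.dvd_sum fun i _ => ?_
      rw [← hf _ i (homogeneousComponent_isHomogeneous i H), ← coeff_gradedEval, h,
        Polynomial.coeff_zero]
    · rintro ⟨Q, rfl⟩
      rw [map_mul, gradedEval_of_isHomogeneous f C.isHomogeneous,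
        (hf _ _ C.isHomogeneous).2 dvd_rfl, map_zero, zero_mul, zero_mul]
  let Θ₀ : C.CoordRing →ₐ[k] D := Ideal.Quotient.liftₐ _ (gradedEval f) (fun H hH =>
    (hker H).2 (Ideal.mem_span_singleton.1 hH))
  have hΘ₀ : Function.Injective Θ₀ := by
    rw [injective_iff_map_eq_zero]
    intro x hx
    obtain ⟨H, rfl⟩ := Ideal.Quotient.mk_surjective x
    have : gradedEval f H = 0 := hx
    rw [Ideal.Quotient.eq_zero_iff_mem, Ideal.mem_span_singleton, ← hker, this]
  have hinj : Function.Injective ((IsScalarTower.toAlgHom k D (FractionRing D)).comp Θ₀) :=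
    (IsFractionRing.injective D (FractionRing D)).comp hΘ₀
  let Θ : C.ConeField →ₐ[k] FractionRing D := IsFractionRing.liftAlgHom hinj
  have hΘ : ∀ H, Θ (C.toConeField H) = algebraMap D (FractionRing D) (gradedEval f H) := fun H =>
    IsFractionRing.lift_algebraMap hinj _
  let ι : RatFunc k →ₐ[k] FractionRing D := IsScalarTower.toAlgHom k (RatFunc k) (FractionRing D)
  have hι : ∀ r, ι r = algebraMap D (FractionRing D) (Polynomial.C r) := fun r => rfl
  have hval : ∀ (x : C.functionField) (d : ℕ)
      (a b : MvPolynomial (Fin 3) k), a.IsHomogeneous d → b.IsHomogeneous d →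
      (x : C.ConeField) = C.toConeField a / C.toConeField b →
      Θ x = ι (aeval f a / aeval f b) := by
    intro x d a b ha hb hx
    have hX : algebraMap D (FractionRing D) (Polynomial.X ^ d) ≠ 0 := by
      rw [Ne, FaithfulSMul.algebraMap_eq_zero_iff]
      exact pow_ne_zero _ Polynomial.X_ne_zero
    rw [hx, map_div₀, hΘ, hΘ, gradedEval_of_isHomogeneous f ha, gradedEval_of_isHomogeneous f hb,
      map_mul, map_mul, mul_div_mul_right _ _ hX, map_div₀, hι, hι]
  have hrange : ∀ x, (Θ.comp C.functionField.val) x ∈ ι.range := by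
    intro x
    obtain ⟨d, a, b, ha, hb, _, hx⟩ := x.2
    exact ⟨_, (hval x d a b ha hb hx).symm⟩
  let e : C.functionField →ₐ[k] RatFunc k :=
    ((AlgEquiv.ofInjective ι ι.toRingHom.injective).symm : ι.range →ₐ[k] RatFunc k).comp
      ((Θ.comp C.functionField.val).codRestrict ι.range hrange)
  refine ⟨e, fun x d a b ha hb hx => ?_⟩
  apply ι.toRingHom.injective
  have h1 := (AlgEquiv.ofInjective ι ι.toRingHom.injective).apply_symm_apply
    (((Θ.comp C.functionField.val).codRestrict ι.range hrange) x)
  have h2 := congrArg Subtype.val h1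
  exact h2.trans (hval x d a b ha hb hx)

/-- The chart as a triple of rational functions. -/
def ratChart (k : Type*) [Field k] (m : ℕ) : Fin 3 → RatFunc k :=
  fun i => algebraMap (Polynomial k) (RatFunc k) (chart k m i)

theorem aeval_ratChart (m : ℕ) (H : MvPolynomial (Fin 3) k) :
    aeval (ratChart k m) H = algebraMap (Polynomial k) (RatFunc k) (aeval (chart k m) H) :=
  (comp_aeval_apply (R := k) (chart k m)
    (IsScalarTower.toAlgHom k (Polynomial k) (RatFunc k)) H).symm

theorem aeval_linCoeff_ne_zero {m : ℕ} (hm : m ≠ 0) :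
    aeval (chart k m) (linCoeff m (X 0) (X 1) (X 2) : MvPolynomial (Fin 3) k) ≠ 0 := by
  have := map_linCoeff (aeval (chart k m) : MvPolynomial (Fin 3) k →ₐ[k] Polynomial k).toRingHom
    m (X 0) (X 1) (X 2)
  refine fun h => linCoeff_phi_ne_zero (k := k) hm ?_
  rw [← h]
  simpa [chart] using this.symm

/-- On the chart w = s and w - y = 1, so w^(m+1) - x(w - y)^m vanishes. -/
theorem aeval_constCoeff (m : ℕ) :
    aeval (chart k m) (X 0 * constCoeff m (X 0) (X 1) (X 2) : MvPolynomial (Fin 3) k) =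
      -(Polynomial.X * aeval (chart k m)
        (linCoeff m (X 0) (X 1) (X 2) : MvPolynomial (Fin 3) k)) := by
  have h1 := map_linCoeff (aeval (chart k m) : MvPolynomial (Fin 3) k →ₐ[k] Polynomial k).toRingHom
    m (X 0) (X 1) (X 2)
  have h2 := map_constCoeff
    (aeval (chart k m) : MvPolynomial (Fin 3) k →ₐ[k] Polynomial k).toRingHom m (X 0) (X 1) (X 2)
  have hw : (Polynomial.X : Polynomial k) ^ 2 + (Polynomial.X ^ (2 * m + 1) - Polynomial.X) *
      Polynomial.X = (Polynomial.X ^ (m + 1)) ^ 2 := by ring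
  have h3 := constCoeff_add_linCoeff (m := m) (y := Polynomial.X - 1) hw
  simp only [AlgHom.toRingHom_eq_coe, RingHom.coe_coe, aeval_X] at h1 h2
  rw [map_mul, aeval_X, h1, h2]
  simp only [chart, Matrix.cons_val_zero, Matrix.cons_val_one, Matrix.cons_val]
  rw [sub_sub_cancel, one_pow] at h3
  linear_combination h3

/-- The parametrization identifies the function field with the field of rational functions. -/
theorem exists_functionField_algEquiv [IsAlgClosed k] {q m : ℕ} {hodd : Odd q} {C : PlaneCurve k}
    (hq : q = 2 * m + 1) (hm : m ≠ 0) (hC : C.points = Set.range (phi q hodd)) :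
    ∃ e : C.functionField ≃ₐ[k] RatFunc k, ∀ (x : C.functionField) (d : ℕ)
      (a b : MvPolynomial (Fin 3) k), a.IsHomogeneous d → b.IsHomogeneous d →
      (x : C.ConeField) = C.toConeField a / C.toConeField b →
      e x = aeval (ratChart k m) a / aeval (ratChart k m) b := by
  have hf : ∀ (H : MvPolynomial (Fin 3) k) (n : ℕ), H.IsHomogeneous n →
      (aeval (ratChart k m) H = 0 ↔ C.form ∣ H) := by
    intro H n hH
    rw [aeval_ratChart, FaithfulSMul.algebraMap_eq_zero_iff, aeval_chart_eq_zero_iff hq hm hC hH]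
  obtain ⟨e, he⟩ := C.exists_functionField_algHom (ratChart k m) hf
  have hX : RatFunc.X ∈ e.fieldRange := by
    -- On the chart a = -s l and y = s - 1, so a + l y = -l. Thus s = a / (a + l y), a quotient of
    -- forms of the same degree m + 1.
    set a : MvPolynomial (Fin 3) k := X 0 * constCoeff m (X 0) (X 1) (X 2) with ha
    set l : MvPolynomial (Fin 3) k := linCoeff m (X 0) (X 1) (X 2) with hl
    have hx : ∀ i : Fin 3, (X i : MvPolynomial (Fin 3) k).IsHomogeneous 1 :=
      fun i => isHomogeneous_X _ _
    have hah : a.IsHomogeneous (m + 1) := by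
      rw [add_comm]
      exact (hx 0).mul (isHomogeneous_constCoeff (hx 0) (hx 1) (hx 2) m)
    have hlh : (l * X 1).IsHomogeneous (m + 1) :=
      (isHomogeneous_linCoeff (hx 0) (hx 1) (hx 2) m).mul (hx 1)
    have hval : aeval (chart k m) (a + l * X 1) = -aeval (chart k m) l := by
      rw [map_add, ha, aeval_constCoeff, ← hl, map_mul, aeval_X]
      simp only [chart, Matrix.cons_val_one, Matrix.cons_val_zero]
      ring
    have hl0 : aeval (chart k m) l ≠ 0 := aeval_linCoeff_ne_zero hm
    have hb0 : C.toConeField (a + l * X 1) ≠ 0 := by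
      rw [Ne, toConeField_eq_zero_iff, ← aeval_chart_eq_zero_iff hq hm hC (hah.add hlh), hval]
      exact neg_ne_zero.2 hl0
    refine ⟨⟨C.toConeField a / C.toConeField (a + l * X 1),
      m + 1, a, a + l * X 1, hah, hah.add hlh, hb0, rfl⟩, ?_⟩
    refine (he _ (m + 1) a (a + l * X 1) hah (hah.add hlh) rfl).trans ?_
    rw [aeval_ratChart, aeval_ratChart, hval, ha, aeval_constCoeff, ← hl, map_neg, map_neg,
      neg_div_neg_eq, map_mul, RatFunc.algebraMap_X, mul_div_cancel_right₀]
    exact RatFunc.algebraMap_ne_zero hl0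
  have hsurj : Function.Surjective e := by
    intro y
    have htop : e.fieldRange = ⊤ := by
      rw [eq_top_iff, ← RatFunc.adjoin_X, IntermediateField.adjoin_simple_le_iff]
      exact hX
    have : y ∈ e.fieldRange := htop ▸ IntermediateField.mem_top
    exact this
  exact ⟨AlgEquiv.ofBijective e ⟨e.toRingHom.injective, hsurj⟩, he⟩

end PlaneCurve

end

/-! ### Projections expressed in the parameter -/

noncomputable section

open MvPolynomial IntermediateField

section Transport

variable {k K K' : Type*} [Field k] [Field K] [Field K'] [Algebra k K] [Algebra k K']

theorem IntermediateField.isGalois_map_algEquiv_iff (e : K ≃ₐ[k] K') (L : IntermediateField k K) :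
    IsGalois L K ↔ IsGalois (L.map e.toAlgHom) K' := by
  have hcomp : (algebraMap (L.map e.toAlgHom) K').comp
      ((intermediateFieldMap e L).toRingEquiv : L →+* L.map e.toAlgHom) =
      (e.toRingEquiv : K →+* K').comp (algebraMap L K) := rfl
  constructor
  · intro h
    exact IsGalois.of_equiv_equiv hcomp
  · intro h
    refine IsGalois.of_equiv_equiv (F := L.map e.toAlgHom) (E := K')
      (f := (intermediateFieldMap e L).symm.toRingEquiv) (g := e.symm.toRingEquiv) ?_
    rfl

/-- Automorphism groups over corresponding subfields are isomorphic. -/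
def IntermediateField.autMapAlgEquiv (e : K ≃ₐ[k] K') (L : IntermediateField k K) :
    (K ≃ₐ[L] K) ≃* (K' ≃ₐ[L.map e.toAlgHom] K') where
  toFun σ := AlgEquiv.ofRingEquiv (f := (e.symm.toRingEquiv.trans σ.toRingEquiv).trans
    e.toRingEquiv) (by
      rintro ⟨_, x, hx, rfl⟩
      have := σ.commutes ⟨x, hx⟩
      change e (σ (e.symm (e x))) = e x
      rw [e.symm_apply_apply]
      exact congrArg e this)
  invFun τ := AlgEquiv.ofRingEquiv (f := (e.toRingEquiv.trans τ.toRingEquiv).trans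
    e.symm.toRingEquiv) (by
      rintro ⟨x, hx⟩
      have := τ.commutes ⟨e x, x, hx, rfl⟩
      change e.symm (τ (e x)) = x
      rw [e.symm_apply_eq]
      exact this)
  left_inv σ := by
    ext x
    change e.symm (e (σ (e.symm (e x)))) = σ x
    simp
  right_inv τ := by
    ext x
    change e (e.symm (τ (e (e.symm x)))) = τ x
    simp
  map_mul' σ τ := by
    ext x
    change e (σ (τ (e.symm x))) = e (σ (e.symm (e (τ (e.symm x)))))
    simp

end Transport

namespace PlaneCurve

variable {k : Type*} [Field k]

theorem exists_linear_coeff {a : MvPolynomial (Fin 3) k} (ha : a.IsHomogeneous 1) :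
    ∃ c : Fin 3 → k, a = ∑ i, C (c i) * X i := by
  have h : a ∈ homogeneousSubmodule (Fin 3) k 1 := ha
  rw [homogeneousSubmodule_one_eq_span_X, Submodule.mem_span_range_iff_exists_fun] at h
  obtain ⟨c, hc⟩ := h
  exact ⟨c, by simp only [← hc, smul_eq_C_mul]⟩

/-- Every linear form vanishing at v is a combination of l₁ and l₂, so one quotient generates the
whole projection field. -/
theorem map_projectionField {Γ : PlaneCurve k} {f : Fin 3 → RatFunc k}
    (e : Γ.functionField ≃ₐ[k] RatFunc k)
    (he : ∀ (x : Γ.functionField) (d : ℕ)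
      (a b : MvPolynomial (Fin 3) k), a.IsHomogeneous d → b.IsHomogeneous d →
      (x : Γ.ConeField) = Γ.toConeField a / Γ.toConeField b →
      e x = aeval f a / aeval f b)
    {v : Fin 3 → k} (hv : v ≠ 0) {l₁ l₂ : MvPolynomial (Fin 3) k}
    (h₁ : l₁.IsHomogeneous 1) (h₂ : l₂.IsHomogeneous 1)
    (hv₁ : eval v l₁ = 0) (hv₂ : eval v l₂ = 0) (hl₂ : Γ.toConeField l₂ ≠ 0)
    (hl₂' : aeval f l₂ ≠ 0)
    (hspan : ∀ c : Fin 3 → k, ∑ i, c i * v i = 0 →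
      ∃ α β, ∑ i, C (c i) * X i = C α * l₁ + C β * l₂) :
    (Γ.projectionField (Projectivization.mk k v hv)).map e.toAlgHom =
      k⟮aeval f l₁ / aeval f l₂⟯ := by
  rw [projectionField, adjoin_map]
  apply le_antisymm
  · rw [adjoin_le_iff]
    rintro _ ⟨x, ⟨a, b, ha, hb, hva, hvb, hb0, hx⟩, rfl⟩
    rw [eval_rep_mk ha] at hva
    rw [eval_rep_mk hb] at hvb
    have hval : e x = aeval f a / aeval f b := he x 1 a b ha hb hx
    have hcomb : ∀ a : MvPolynomial (Fin 3) k, a.IsHomogeneous 1 → eval v a = 0 →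
        ∃ u ∈ k⟮aeval f l₁ / aeval f l₂⟯, aeval f a = u * aeval f l₂ := by
      intro a ha hva
      obtain ⟨c, rfl⟩ := exists_linear_coeff ha
      obtain ⟨α, β, h⟩ := hspan c (by simpa using hva)
      refine ⟨algebraMap k _ α * (aeval f l₁ / aeval f l₂) + algebraMap k _ β, ?_, ?_⟩
      · exact add_mem (mul_mem (_root_.algebraMap_mem _ α) (mem_adjoin_simple_self _ _))
          (_root_.algebraMap_mem _ β)
      · rw [h, map_add, map_mul, map_mul, algHom_C, algHom_C]
        field_simp
    obtain ⟨u, hu, hau⟩ := hcomb a ha hva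
    obtain ⟨w, hw, hbw⟩ := hcomb b hb hvb
    change e x ∈ _
    rw [hval, hau, hbw, mul_div_mul_right _ _ hl₂']
    exact div_mem hu hw
  · rw [adjoin_simple_le_iff]
    apply subset_adjoin
    let y : Γ.functionField := ⟨Γ.toConeField l₁ / Γ.toConeField l₂, 1, l₁, l₂, h₁, h₂, hl₂, rfl⟩
    exact ⟨y, ⟨l₁, l₂, h₁, h₂, (eval_rep_mk h₁ _ _).2 hv₁, (eval_rep_mk h₂ _ _).2 hv₂, hl₂, rfl⟩,
      he y 1 l₁ l₂ h₁ h₂ rfl⟩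

theorem isGaloisPoint_iff [IsAlgClosed k] {q m : ℕ} {hodd : Odd q} {Γ : PlaneCurve k}
    (hq : q = 2 * m + 1) (hm : m ≠ 0) (hC : Γ.points = Set.range (phi q hodd))
    {v : Fin 3 → k} (hv : v ≠ 0) {l₁ l₂ : MvPolynomial (Fin 3) k}
    (h₁ : l₁.IsHomogeneous 1) (h₂ : l₂.IsHomogeneous 1)
    (hv₁ : eval v l₁ = 0) (hv₂ : eval v l₂ = 0)
    (hl₂ : aeval (chart k m) l₂ ≠ 0)
    (hspan : ∀ c : Fin 3 → k, ∑ i, c i * v i = 0 →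
      ∃ α β, ∑ i, C (c i) * X i = C α * l₁ + C β * l₂)
    {f : RatFunc k} (hf : f = algebraMap (Polynomial k) (RatFunc k) (aeval (chart k m) l₁) /
      algebraMap (Polynomial k) (RatFunc k) (aeval (chart k m) l₂)) :
    (Γ.IsGaloisPoint (Projectivization.mk k v hv) ↔ IsGalois k⟮f⟯ (RatFunc k)) ∧
      Nonempty (Γ.galoisGroup (Projectivization.mk k v hv) ≃*
        (RatFunc k ≃ₐ[k⟮f⟯] RatFunc k)) := by
  obtain ⟨e, he⟩ := exists_functionField_algEquiv hq hm hC
  have h0 : Γ.toConeField l₂ ≠ 0 := by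
    rwa [Ne, toConeField_eq_zero_iff, ← aeval_chart_eq_zero_iff hq hm hC h₂]
  have h0' : aeval (ratChart k m) l₂ ≠ 0 := by
    rw [aeval_ratChart]
    exact RatFunc.algebraMap_ne_zero hl₂
  have hmap := map_projectionField e he hv h₁ h₂ hv₁ hv₂ h0 h0' hspan
  rw [aeval_ratChart, aeval_ratChart, ← hf] at hmap
  rw [← hmap]
  exact ⟨isGalois_map_algEquiv_iff e _, ⟨autMapAlgEquiv e _⟩⟩

end PlaneCurve

end

/-! ### Local properties of the explicit equation -/

noncomputable section

open MvPolynomial IntermediateField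

namespace PlaneCurve

variable {k : Type*} [Field k]

/-- The equation of the image of `φ₁`. -/
def curveForm (k : Type*) [Field k] (m : ℕ) : MvPolynomial (Fin 3) k :=
  curveEq m (X 0) (X 1) (X 2)

theorem isHomogeneous_curveForm (m : ℕ) : (curveForm k m).IsHomogeneous (2 * m + 1) :=
  isHomogeneous_curveEq (isHomogeneous_X _ _) (isHomogeneous_X _ _) (isHomogeneous_X _ _) m

theorem aeval_curveForm {A : Type*} [CommRing A] [Algebra k A] (f : Fin 3 → A) (m : ℕ) :
    aeval f (curveForm k m) = curveEq m (f 0) (f 1) (f 2) := by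
  have := map_curveEq (aeval f : MvPolynomial (Fin 3) k →ₐ[k] A).toRingHom m (X 0) (X 1) (X 2)
  simpa [curveForm] using this

theorem eval_curveForm (v : Fin 3 → k) (m : ℕ) :
    eval v (curveForm k m) = curveEq m (v 0) (v 1) (v 2) :=
  aeval_curveForm v m

theorem curveForm_ne_zero (m : ℕ) : curveForm k m ≠ 0 := by
  intro h
  have := eval_curveForm (![1, 0, 1] : Fin 3 → k) m
  rw [h, map_zero] at this
  simp [curveEq_middle_zero] at this
  exact pow_ne_zero m (neg_ne_zero.2 one_ne_zero) this.symm

theorem aeval_chart_curveForm {m : ℕ} (hm : m ≠ 0) :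
    aeval (chart k m) (curveForm k m) = 0 := by
  rw [aeval_curveForm]
  have := curveEq_phi hm (Polynomial.X : Polynomial k) 1
  simpa [chart] using this

/-- Along (X : 1 : 0) the equation becomes X(c² - l²), where c and l have values ±1 and 0 at X = 0;
its derivative there is 1. -/
theorem eval_pderiv_zero_curveForm {m : ℕ} (hm : m ≠ 0) :
    eval ![0, 1, 0] (pderiv 0 (curveForm k m)) ≠ 0 := by
  have h := MvPolynomial.derivative_aeval (![Polynomial.X, 1, 0] : Fin 3 → Polynomial k)
    (curveForm k m)
  have h0 := congrArg (Polynomial.eval 0) h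
  rw [aeval_curveForm, Fin.sum_univ_three] at h0
  have hc : Polynomial.eval 0 (constCoeff m (Polynomial.X : Polynomial k) 1 0) =
      -(-1) ^ m := by
    rw [← Polynomial.coe_evalRingHom, map_constCoeff]
    simp [constCoeff, binomPow_zero_fst]
  have hl : Polynomial.eval 0 (linCoeff m (Polynomial.X : Polynomial k) 1 0) = 0 := by
    rw [← Polynomial.coe_evalRingHom, map_linCoeff]
    simp [linCoeff, binomPow_zero_zero_snd, hm]
  simp [curveEq, hc, hl, eval_aeval_polynomial] at h0
  intro h1
  have h2 : (fun i => Polynomial.eval 0 ((![Polynomial.X, 1, 0] : Fin 3 → Polynomial k) i)) =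
      ![0, 1, 0] := by
    funext i
    fin_cases i <;> simp
  rw [h2, h1] at h0
  simp at h0

/-- Along (1 : 0 : X) the equation is linear, (-1)^m X. -/
theorem eval_pderiv_two_curveForm (m : ℕ) :
    eval ![1, 0, 0] (pderiv 2 (curveForm k m)) ≠ 0 := by
  have h := MvPolynomial.derivative_aeval (![1, 0, Polynomial.X] : Fin 3 → Polynomial k)
    (curveForm k m)
  have h0 := congrArg (Polynomial.eval 0) h
  rw [aeval_curveForm, Fin.sum_univ_three] at h0
  have h2 : (fun i => Polynomial.eval 0 ((![1, 0, Polynomial.X] : Fin 3 → Polynomial k) i)) =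
      ![1, 0, 0] := by
    funext i
    fin_cases i <;> simp
  simp only [Matrix.cons_val_zero, Matrix.cons_val_one, Matrix.cons_val, curveEq_middle_zero] at h0
  rw [Polynomial.eval_add, Polynomial.eval_add, Polynomial.eval_mul, Polynomial.eval_mul,
    Polynomial.eval_mul, eval_aeval_polynomial, eval_aeval_polynomial, eval_aeval_polynomial, h2]
    at h0
  intro h1
  have h3 : (Polynomial.X * (-1 ^ 2) ^ m : Polynomial k) =
      Polynomial.C ((-1) ^ m) * Polynomial.X := by
    simp [mul_comm]
  rw [h1, h3] at h0
  simp at h0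

/-- Vanishing at (1 : 0 : 0) removes the pure power of the first variable. -/
theorem natDegree_aeval_X_lt {L : Type*} [CommRing L] [Algebra k L] {F : MvPolynomial (Fin 3) k}
    {d : ℕ} (hd : d ≠ 0) (hF : F.IsHomogeneous d) (h0 : eval ![1, 0, 0] F = 0) (b c : L) :
    (aeval ![Polynomial.X, Polynomial.C b, Polynomial.C c] F : Polynomial L).natDegree < d := by
  have hsum : ∀ s, F.coeff s ≠ 0 → s 0 + s 1 + s 2 = d := by
    intro s hs
    have h1 := hF hs
    rw [Finsupp.weight_apply, Finsupp.sum_fintype _ _ (by simp)] at h1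
    simpa [Fin.sum_univ_three] using h1
  have hlt : ∀ s, F.coeff s ≠ 0 → s 0 < d := by
    intro s hs
    have h1 := hsum s hs
    by_contra hge
    have e0 : s 0 = d := by omega
    apply hs
    rw [← h0, eval_eq', Finset.sum_eq_single s]
    · have e1 : s 1 = 0 := by omega
      have e2 : s 2 = 0 := by omega
      simp [Fin.prod_univ_three, e1, e2]
    · intro t ht hts
      have h2 := hsum t (mem_support_iff.1 ht)
      have h3 : t 1 ≠ 0 ∨ t 2 ≠ 0 := by
        by_contra hcon
        push Not at hcon
        apply hts
        ext i
        fin_cases i <;> simp <;> omega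
      rcases h3 with h3 | h3 <;> simp [Fin.prod_univ_three, h3]
    · intro h2
      rw [notMem_support_iff.1 h2, zero_mul]
  rw [aeval_def, eval₂_eq']
  refine lt_of_le_of_lt (Polynomial.natDegree_sum_le_of_forall_le (n := d - 1) _ _ ?_) (by omega)
  intro s hs
  have h1 := hlt s (mem_support_iff.1 hs)
  rw [Fin.prod_univ_three]
  simp only [Matrix.cons_val_zero, Matrix.cons_val_one, Matrix.cons_val]
  have e : (algebraMap k (Polynomial L)) (coeff s F) *
      (Polynomial.X ^ s 0 * Polynomial.C b ^ s 1 * Polynomial.C c ^ s 2) =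
      Polynomial.C (algebraMap k L (coeff s F) * (b ^ s 1 * c ^ s 2)) * Polynomial.X ^ s 0 := by
    rw [IsScalarTower.algebraMap_apply k L (Polynomial L)]
    simp only [Polynomial.algebraMap_eq, map_mul, map_pow]
    ring
  rw [e]
  exact (Polynomial.natDegree_C_mul_X_pow_le _ _).trans (by omega)

theorem X_pow_sub_X_eq (p : ℕ) [CharP k p] [Fact p.Prime] {q n m : ℕ} (hqp : q = p ^ n)
    (hq : q = 2 * m + 1) : (Polynomial.X ^ (2 * m + 1) - Polynomial.X : Polynomial k) =
      (Polynomial.X - 1) * ((Polynomial.X - 1) ^ (2 * m) - 1) := by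
  have h : (Polynomial.X - 1 : Polynomial k) ^ (2 * m + 1) = Polynomial.X ^ (2 * m + 1) - 1 := by
    rw [← hq, hqp, sub_pow_char_pow, one_pow]
  rw [mul_sub, ← pow_succ', h]
  ring

end PlaneCurve

end

/-! ### Degree and irreducibility of the image -/

noncomputable section

open MvPolynomial IntermediateField

namespace PlaneCurve

variable {k : Type*} [Field k] {q m n : ℕ} {hodd : Odd q} {Γ : PlaneCurve k}

/-- On the image y + z = (s - t)^q, so the line y + z = 0 meets it only at φ₁(1 : 1) = (1 : 0 : 0).
-/
theorem eval_form_ne_zero_of_unique_line (p : ℕ) [CharP k p] [Fact p.Prime] (hqp : q = p ^ n)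
    (hq : q = 2 * m + 1) (hC : Γ.points = Set.range (phi q hodd)) :
    eval ![0, 1, -1] Γ.form ≠ 0 := by
  intro h
  rw [← mk_mem_points Γ ![0, 1, -1] (by simp), hC] at h
  obtain ⟨P, hP⟩ := h
  induction P using Projectivization.ind with
  | h v hv =>
    rw [phi_mk, Projectivization.mk_eq_mk_iff'] at hP
    obtain ⟨a, ha⟩ := hP
    have hv' : v = ![v 0, v 1] := by
      funext i
      fin_cases i <;> rfl
    generalize v 0 = s at hv'
    generalize v 1 = t at hv'
    subst hv'
    rw [phiVec_odd hq] at ha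
    have h1 := congrFun ha 1
    have h2 := congrFun ha 2
    have h0 := congrFun ha 0
    simp at h0 h1 h2
    have hpow : (s - t) ^ (2 * m + 1) = 0 := by
      rw [← hq, hqp, sub_pow_char_pow, ← hqp, hq]
      linear_combination -h1 - h2
    have hst := sub_eq_zero.1 (eq_zero_of_pow_eq_zero hpow)
    subst hst
    have hs : s = 0 := h0.elim id fun h => h.1
    simp [hs] at hv

theorem degree_ne_zero (Γ : PlaneCurve k) : Γ.degree ≠ 0 := by
  intro h
  have h1 := Γ.isHomogeneous.totalDegree Γ.irreducible.ne_zero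
  rw [h, totalDegree_eq_zero_iff_eq_C] at h1
  apply Γ.irreducible.not_isUnit
  rw [h1]
  refine IsUnit.map C (isUnit_iff_ne_zero.2 fun h0 => Γ.irreducible.ne_zero ?_)
  rw [h1, h0, map_zero]

theorem isSmoothPoint_mk {v : Fin 3 → k} (hv : v ≠ 0) (hmem : Projectivization.mk k v hv ∈ Γ.points)
    {c : k} (hc : curveForm k m = Γ.form * C c) {i : Fin 3}
    (hi : eval v (pderiv i (curveForm k m)) ≠ 0) :
    Γ.IsSmoothPoint (Projectivization.mk k v hv) := by
  refine ⟨hmem, i, ?_⟩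
  rw [Ne, eval_rep_mk Γ.isHomogeneous.pderiv]
  intro h
  apply hi
  rw [hc, mul_comm, pderiv_C_mul, map_mul, h, mul_zero]

variable [IsAlgClosed k]

/-- Set y = 1. Then k(s) = k(u)(x) has degree 2m over k(u), where u = z/y. The form yields an
equation for x over k(u) whose degree is less than that of the curve, because (1 : 0 : 0) lies on
the curve. -/
theorem le_degree (p : ℕ) [CharP k p] [Fact p.Prime] (hqp : q = p ^ n)
    (hq : q = 2 * m + 1) (hm : m ≠ 0) (hC : Γ.points = Set.range (phi q hodd)) :
    q ≤ Γ.degree := by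
  have hn : n ≠ 0 := by
    rintro rfl
    simp at hqp
    omega
  have h2m : ((2 * m : ℕ) : k) ≠ 0 := by
    have h1 : ((2 * m + 1 : ℕ) : k) = 0 := by
      rw [← hq, hqp, Nat.cast_pow, CharP.cast_eq_zero, zero_pow hn]
    intro h2
    rw [Nat.cast_add, h2] at h1
    simp at h1
  set B : Polynomial k := (Polynomial.X - 1) ^ (2 * m) - 1 with hB
  set u : RatFunc k := algebraMap (Polynomial k) (RatFunc k) B with hu
  set g : RatFunc k := algebraMap (Polynomial k) (RatFunc k) 1 / u with hg
  have hfin := (RatFunc.isGalois_adjoin_kummer h2m hg).1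
  have huL : u ∈ k⟮g⟯ := by
    have := inv_mem (mem_adjoin_simple_self k g)
    rwa [hg, map_one, one_div, inv_inv, ← one_div, ← map_one (algebraMap (Polynomial k) _),
      ← hg] at this
  set x : RatFunc k := ratChart k m 0 / ratChart k m 1 with hx
  have hy0 : ratChart k m 1 ≠ 0 := by
    simp only [ratChart, chart, Matrix.cons_val_one, Matrix.cons_val_zero]
    exact RatFunc.algebraMap_ne_zero (Polynomial.X_sub_C_ne_zero 1)
  have hchart : ratChart k m = fun i => ratChart k m 1 * (![x, 1, u] : Fin 3 → RatFunc k) i := by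
    funext i
    fin_cases i
    · simp [hx, mul_div_cancel₀ _ hy0]
    · simp
    · simp [ratChart, chart, hu, hB, X_pow_sub_X_eq p hqp hq]
  have hscale : ∀ (H : MvPolynomial (Fin 3) k) (d : ℕ), H.IsHomogeneous d →
      aeval (ratChart k m) H = ratChart k m 1 ^ d * aeval ![x, 1, u] H := by
    intro H d hH
    conv_lhs => rw [hchart]
    exact hH.aeval_mul _ _
  let P : Polynomial k⟮g⟯ := aeval ![Polynomial.X, Polynomial.C 1, Polynomial.C ⟨u, huL⟩] Γ.form
  have haevalP : ∀ r : RatFunc k, Polynomial.aeval r P = aeval ![r, 1, u] Γ.form := by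
    intro r
    have := comp_aeval_apply (R := k)
      (![Polynomial.X, Polynomial.C 1, Polynomial.C ⟨u, huL⟩] : Fin 3 → Polynomial k⟮g⟯)
      ((Polynomial.aeval r : Polynomial k⟮g⟯ →ₐ[k⟮g⟯] RatFunc k).restrictScalars k) Γ.form
    refine this.trans ?_
    congr 2
    funext i
    fin_cases i <;> simp
  have hP0 : P ≠ 0 := by
    intro h
    have h1 := haevalP 0
    rw [h, map_zero] at h1
    have h2 := comp_aeval_apply (R := k) (![0, 1, B] : Fin 3 → Polynomial k)
      (IsScalarTower.toAlgHom k (Polynomial k) (RatFunc k)) Γ.form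
    have h3 : (fun i => IsScalarTower.toAlgHom k (Polynomial k) (RatFunc k)
        ((![0, 1, B] : Fin 3 → Polynomial k) i)) = ![0, 1, u] := by
      funext i
      fin_cases i <;> simp [hu]
    rw [h3, ← h1] at h2
    have h4 : aeval (![0, 1, B] : Fin 3 → Polynomial k) Γ.form = 0 :=
      RatFunc.algebraMap_injective k (h2.trans (map_zero _).symm)
    -- At s = 1 the function u takes the value -1, which leads to the point (0 : 1 : -1) off the
    -- curve.
    have h5 := congrArg (Polynomial.eval 1) h4
    rw [eval_aeval_polynomial, Polynomial.eval_zero] at h5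
    apply eval_form_ne_zero_of_unique_line p hqp hq hC
    have h6 : (fun i => Polynomial.eval 1 ((![0, 1, B] : Fin 3 → Polynomial k) i)) =
        ![0, 1, -1] := by
      funext i
      fin_cases i <;> simp [hB, hm]
    rwa [h6] at h5
  have hPx : Polynomial.aeval x P = 0 := by
    rw [haevalP]
    have h1 := hscale _ _ Γ.isHomogeneous
    rw [aeval_ratChart, aeval_chart_form hq hC, map_zero] at h1
    exact (mul_eq_zero.1 h1.symm).resolve_left (pow_ne_zero _ hy0)
  have hint : IsIntegral k⟮g⟯ x := IsAlgebraic.isIntegral ⟨P, hP0, hPx⟩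
  have htop : k⟮g⟯⟮x⟯ = ⊤ := by
    rw [eq_top_iff]
    intro r _
    obtain ⟨e, he⟩ := exists_functionField_algEquiv hq hm hC
    obtain ⟨z, rfl⟩ := e.surjective r
    obtain ⟨d, a, b, ha, hb, hb0, hz⟩ := z.2
    rw [he z d a b ha hb hz, hscale a d ha, hscale b d hb,
      mul_div_mul_left _ _ (pow_ne_zero _ hy0)]
    have hmem : ∀ H : MvPolynomial (Fin 3) k, aeval ![x, 1, u] H ∈ k⟮g⟯⟮x⟯ := by
      intro H
      induction H using MvPolynomial.induction_on with
      | C c =>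
        rw [algHom_C, IsScalarTower.algebraMap_apply k k⟮g⟯ (RatFunc k)]
        exact IntermediateField.algebraMap_mem _ _
      | add p q hp hq =>
        rw [map_add]
        exact add_mem hp hq
      | mul_X p i hp =>
        rw [map_mul, aeval_X]
        refine mul_mem hp ?_
        fin_cases i
        · exact mem_adjoin_simple_self _ _
        · exact one_mem _
        · exact IntermediateField.algebraMap_mem k⟮g⟯⟮x⟯ (⟨u, huL⟩ : k⟮g⟯)
    exact div_mem (hmem a) (hmem b)
  have hdeg : 2 * m ≤ P.natDegree := by
    rw [← hfin, ← finrank_top', ← htop, adjoin.finrank hint]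
    exact Polynomial.natDegree_le_natDegree (minpoly.degree_le_of_ne_zero _ _ hP0 hPx)
  have h100 : eval ![1, 0, 0] Γ.form = 0 := by
    have := eval_phiVec hC ![1, 1] (by simp)
    rw [phiVec_odd hq] at this
    simpa using this
  have := natDegree_aeval_X_lt Γ.degree_ne_zero Γ.isHomogeneous h100 (1 : k⟮g⟯) ⟨u, huL⟩
  change P.natDegree < _ at this
  omega

theorem degree_eq_and_exists_curveForm_eq (p : ℕ) [CharP k p] [Fact p.Prime] (hqp : q = p ^ n)
    (hq : q = 2 * m + 1) (hm : m ≠ 0) (hC : Γ.points = Set.range (phi q hodd)) :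
    Γ.degree = q ∧ ∃ c : k, curveForm k m = Γ.form * C c := by
  have hle := le_degree p hqp hq hm hC
  obtain ⟨H, hH⟩ := form_dvd_of_aeval_chart hq hm hC (isHomogeneous_curveForm m)
    (aeval_chart_curveForm hm)
  have hne := curveForm_ne_zero (k := k) m
  have hH0 : H ≠ 0 := by
    rintro rfl
    rw [mul_zero] at hH
    exact hne hH
  have h1 := (isHomogeneous_curveForm (k := k) m).totalDegree hne
  rw [hH, totalDegree_mul_of_isDomain Γ.irreducible.ne_zero hH0,
    Γ.isHomogeneous.totalDegree Γ.irreducible.ne_zero] at h1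
  refine ⟨by omega, H.coeff 0, ?_⟩
  rw [← totalDegree_eq_zero_iff_eq_C.1 (by omega : H.totalDegree = 0), hH]

/-- The image of `φ₁` is an irreducible plane curve. -/
theorem exists_points_eq_range_phi (hodd : Odd q) (hq : q = 2 * m + 1) (hm : m ≠ 0) :
    ∃ Γ : PlaneCurve k, Γ.points = Set.range (phi q hodd) := by
  have hG0 := curveForm_ne_zero (k := k) m
  have hprod := UniqueFactorizationMonoid.factors_prod hG0
  -- The product of the irreducible factors vanishes on the chart, so one factor does. It then
  -- vanishes on the whole image, and as a divisor of the explicit form it has no other zeros.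
  have hzero : aeval (chart k m) (UniqueFactorizationMonoid.factors (curveForm k m)).prod = 0 := by
    obtain ⟨u, hu⟩ := hprod
    have h1 := aeval_chart_curveForm (k := k) hm
    rw [← hu, map_mul] at h1
    exact (mul_eq_zero.1 h1).resolve_right (u.isUnit.map _).ne_zero
  rw [map_multiset_prod, Multiset.prod_eq_zero_iff, Multiset.mem_map] at hzero
  obtain ⟨F, hF, hF0⟩ := hzero
  have hdvd := UniqueFactorizationMonoid.dvd_of_mem_factors hF
  have hirr := UniqueFactorizationMonoid.irreducible_of_factor F hF
  obtain ⟨d, hd⟩ := exists_isHomogeneous_of_dvd (isHomogeneous_curveForm m) hG0 hdvd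
  refine ⟨⟨F, d, hirr, hd⟩, ?_⟩
  have hphi := eval_phiVec_of_aeval_chart hodd hq hm hd hF0
  ext P
  induction P using Projectivization.ind with
  | h v hv =>
    rw [mk_mem_points]
    constructor
    · intro h
      change eval v F = 0 at h
      obtain ⟨Q, hQ⟩ := hdvd
      have h1 : curveEq m (v 0) (v 1) (v 2) = 0 := by
        rw [← eval_curveForm, hQ, map_mul, h, zero_mul]
      obtain ⟨s, t, h0, h1, h2⟩ := exists_phi_of_curveEq hm h1
      have hvs : phiVec q ![s, t] = v := by
        rw [phiVec_odd hq]
        funext i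
        fin_cases i
        · exact h0.symm
        · exact h1.symm
        · exact h2.symm
      have hst : (![s, t] : Fin 2 → k) ≠ 0 := by
        intro h3
        apply hv
        rw [← hvs, h3, phiVec]
        funext i
        fin_cases i <;> simp [hq]
      refine ⟨Projectivization.mk k ![s, t] hst, ?_⟩
      rw [phi_mk]
      simp only [hvs]
    · rintro ⟨P, hP⟩
      induction P using Projectivization.ind with
      | h w hw =>
        rw [phi_mk, Projectivization.mk_eq_mk_iff'] at hP
        obtain ⟨a, ha⟩ := hP
        have h1 := hphi w hw
        change eval v F = 0
        rw [← ha, eval_smul_of_isHomogeneous hd] at h1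
        refine (mul_eq_zero.1 h1).resolve_left (pow_ne_zero _ ?_)
        rintro rfl
        rw [zero_smul] at ha
        exact phiVec_ne_zero hodd hw ha.symm

end PlaneCurve

end

/-! ### Deciding which points are Galois -/

noncomputable section

open MvPolynomial IntermediateField

namespace PlaneCurve

variable {k : Type*} [Field k] [IsAlgClosed k] {q m n : ℕ} {hodd : Odd q} {Γ : PlaneCurve k}

theorem isGaloisPoint_iff_of_middle_ne_zero (hq : q = 2 * m + 1) (hm : m ≠ 0)
    (hC : Γ.points = Set.range (phi q hodd)) {v : Fin 3 → k} (hv : v ≠ 0) (hv1 : v 1 ≠ 0)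
    {f : RatFunc k} (hf : f = algebraMap (Polynomial k) (RatFunc k) (Polynomial.X ^ (m + 1) -
        Polynomial.C (v 0 / v 1) * (Polynomial.X - 1)) /
      algebraMap (Polynomial k) (RatFunc k) (Polynomial.X ^ q - Polynomial.X -
        Polynomial.C (v 2 / v 1) * (Polynomial.X - 1))) :
    (Γ.IsGaloisPoint (Projectivization.mk k v hv) ↔ IsGalois k⟮f⟯ (RatFunc k)) ∧
      Nonempty (Γ.galoisGroup (Projectivization.mk k v hv) ≃*
        (RatFunc k ≃ₐ[k⟮f⟯] RatFunc k)) := by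
  have hlin : ∀ (i j : Fin 3) (c : k),
      (X i - C c * X j : MvPolynomial (Fin 3) k).IsHomogeneous 1 := fun i j c =>
    (isHomogeneous_X _ _).sub (isHomogeneous_C_mul_X _ _)
  refine isGaloisPoint_iff hq hm hC hv (l₁ := X 0 - C (v 0 / v 1) * X 1)
    (l₂ := X 2 - C (v 2 / v 1) * X 1) (hlin _ _ _) (hlin _ _ _) ?_ ?_ ?_ ?_ ?_
  · simp [div_mul_cancel₀ _ hv1]
  · simp [div_mul_cancel₀ _ hv1]
  · have h : aeval (chart k m) (X 2 - C (v 2 / v 1) * X 1 : MvPolynomial (Fin 3) k) =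
        Polynomial.X ^ (2 * m + 1) - Polynomial.X -
          Polynomial.C (v 2 / v 1) * (Polynomial.X - 1) := by
      simp [chart]
    rw [h]
    intro h0
    have h1 := natDegree_X_pow_sub_X_sub_smul (2 * m + 1) (by omega) (v 2 / v 1)
    rw [h0, Polynomial.natDegree_zero] at h1
    omega
  · intro c hc
    rw [Fin.sum_univ_three] at hc
    refine ⟨c 0, c 2, ?_⟩
    have h1 : c 1 = -(c 0 * (v 0 / v 1) + c 2 * (v 2 / v 1)) := by
      field_simp
      linear_combination hc
    rw [Fin.sum_univ_three, h1]
    simp only [map_neg, map_add, map_mul]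
    ring
  · rw [hf, hq]
    simp [chart]

theorem isGaloisPoint_first (hq : q = 2 * m + 1) (hm : (m : k) ≠ 0)
    (hC : Γ.points = Set.range (phi q hodd)) :
    Γ.IsGaloisPoint (planePoint 0 1 0 (by simp)) ∧
      Nonempty (Γ.galoisGroup (planePoint 0 1 0 (by simp)) ≃* DihedralGroup m) := by
  have hm0 : m ≠ 0 := by
    rintro rfl
    simp at hm
  -- The common factor X reflects that P₁ lies on the curve, at s = 0.
  have hf : algebraMap (Polynomial k) (RatFunc k) (Polynomial.X ^ m) /
      algebraMap (Polynomial k) (RatFunc k) (Polynomial.X ^ (2 * m) - 1) =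
      algebraMap (Polynomial k) (RatFunc k) (Polynomial.X ^ (m + 1) -
        Polynomial.C ((![0, 1, 0] : Fin 3 → k) 0 / (![0, 1, 0] : Fin 3 → k) 1) *
          (Polynomial.X - 1)) /
      algebraMap (Polynomial k) (RatFunc k) (Polynomial.X ^ q - Polynomial.X -
        Polynomial.C ((![0, 1, 0] : Fin 3 → k) 2 / (![0, 1, 0] : Fin 3 → k) 1) *
          (Polynomial.X - 1)) := by
    have e1 : (Polynomial.X ^ (m + 1) -
        Polynomial.C ((![0, 1, 0] : Fin 3 → k) 0 / (![0, 1, 0] : Fin 3 → k) 1) *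
          (Polynomial.X - 1) : Polynomial k) = Polynomial.X * Polynomial.X ^ m := by
      simp [pow_succ']
    have e2 : (Polynomial.X ^ q - Polynomial.X -
        Polynomial.C ((![0, 1, 0] : Fin 3 → k) 2 / (![0, 1, 0] : Fin 3 → k) 1) *
          (Polynomial.X - 1) : Polynomial k) =
        Polynomial.X * (Polynomial.X ^ (2 * m) - 1) := by
      rw [hq]
      simp [pow_succ', mul_sub]
    rw [e1, e2, map_mul, map_mul, mul_div_mul_left]
    exact RatFunc.algebraMap_ne_zero Polynomial.X_ne_zero
  obtain ⟨h1, ⟨h2⟩⟩ := isGaloisPoint_iff_of_middle_ne_zero hq hm0 hC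
    (v := ![0, 1, 0]) (by simp) (by simp) hf
  obtain ⟨h3, ⟨h4⟩⟩ := RatFunc.isGalois_adjoin_dihedral hm rfl
  exact ⟨h1.2 h3, ⟨h2.trans h4⟩⟩

theorem isGaloisPoint_second (p : ℕ) [CharP k p] [Fact p.Prime] (hqp : q = p ^ n)
    (hq : q = 2 * m + 1) (hm : ((2 * m : ℕ) : k) ≠ 0)
    (hC : Γ.points = Set.range (phi q hodd)) :
    Γ.IsGaloisPoint (planePoint 1 0 0 (by simp)) ∧
      Nonempty (Γ.galoisGroup (planePoint 1 0 0 (by simp)) ≃* Multiplicative (ZMod (2 * m))) := by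
  have hm0 : m ≠ 0 := by
    rintro rfl
    simp at hm
  have hX2 : aeval (chart k m) (X 2 : MvPolynomial (Fin 3) k) =
      Polynomial.X ^ (2 * m + 1) - Polynomial.X := by
    simp [chart]
  have hX1 : aeval (chart k m) (X 1 : MvPolynomial (Fin 3) k) = Polynomial.X - 1 := by
    simp [chart]
  have hne : (Polynomial.X ^ (2 * m + 1) - Polynomial.X : Polynomial k) ≠ 0 := by
    intro h0
    have h1 := natDegree_X_pow_sub_X_sub_smul (2 * m + 1) (by omega) (0 : k)
    rw [map_zero, zero_mul, sub_zero, h0, Polynomial.natDegree_zero] at h1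
    omega
  -- Here the function is y/z, and X^q - X = (X - 1)((X - 1)^(2m) - 1) in characteristic p.
  have hf : algebraMap (Polynomial k) (RatFunc k) 1 /
      algebraMap (Polynomial k) (RatFunc k) ((Polynomial.X - 1) ^ (2 * m) - 1) =
      algebraMap (Polynomial k) (RatFunc k) (aeval (chart k m) (X 1 : MvPolynomial (Fin 3) k)) /
      algebraMap (Polynomial k) (RatFunc k)
        (aeval (chart k m) (X 2 : MvPolynomial (Fin 3) k)) := by
    have h1 := X_pow_sub_X_eq (k := k) p hqp hq
    rw [hX1, hX2, h1, map_mul]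
    nth_rewrite 2 [← mul_one (Polynomial.X - 1 : Polynomial k)]
    rw [map_mul, mul_div_mul_left]
    exact RatFunc.algebraMap_ne_zero (Polynomial.X_sub_C_ne_zero 1)
  obtain ⟨h1, ⟨h2⟩⟩ := isGaloisPoint_iff hq hm0 hC (v := ![1, 0, 0]) (by simp)
    (isHomogeneous_X k 1) (isHomogeneous_X k 2) (by simp) (by simp) (by rwa [hX2]) (by
      intro c hc
      rw [Fin.sum_univ_three] at hc
      refine ⟨c 1, c 2, ?_⟩
      have h0 : c 0 = 0 := by simpa using hc
      rw [Fin.sum_univ_three, h0]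
      simp) hf
  obtain ⟨_, h3, ⟨h4⟩⟩ := RatFunc.isGalois_adjoin_kummer hm rfl
  exact ⟨h1.2 h3, ⟨h2.trans h4⟩⟩

theorem not_isGaloisPoint_at_infinity (hq : q = 2 * m + 1) (hm : 2 ≤ m)
    (hC : Γ.points = Set.range (phi q hodd)) :
    ¬Γ.IsGaloisPoint (planePoint 0 0 1 (by simp)) := by
  have hX0 : aeval (chart k m) (X 0 : MvPolynomial (Fin 3) k) = Polynomial.X ^ (m + 1) := by
    simp [chart]
  have hX1 : aeval (chart k m) (X 1 : MvPolynomial (Fin 3) k) = Polynomial.X - 1 := by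
    simp [chart]
  obtain ⟨h1, _⟩ := isGaloisPoint_iff hq (by omega) hC (v := ![0, 0, 1]) (by simp)
    (isHomogeneous_X k 1) (isHomogeneous_X k 0) (by simp) (by simp)
    (by
      rw [hX0]
      exact pow_ne_zero _ Polynomial.X_ne_zero)
    (by
      intro c hc
      rw [Fin.sum_univ_three] at hc
      refine ⟨c 1, c 0, ?_⟩
      have h0 : c 2 = 0 := by simpa using hc
      rw [Fin.sum_univ_three, h0, map_zero]
      ring) rfl
  intro h
  have h2 := (h1.1 h).to_normal
  rw [hX0, hX1] at h2
  exact RatFunc.not_normal_adjoin_linear_div_pow hm rfl h2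

theorem not_isGaloisPoint_of_ne (p : ℕ) [CharP k p] (hp : p.Prime) (hqp : q = p ^ n)
    (hq : q = 2 * m + 1) (hm : 2 ≤ m) (hC : Γ.points = Set.range (phi q hodd)) {a : k}
    (ha0 : a ≠ 0) (ha1 : a ≠ 1) (hv : phiVec q ![a, 1] ≠ 0) :
    ¬Γ.IsGaloisPoint (Projectivization.mk k (phiVec q ![a, 1]) hv) := by
  have hv' : phiVec q ![a, 1] = ![a ^ (m + 1), a - 1, a ^ q - a] := by
    rw [phiVec_odd hq, hq]
    simp
  simp only [hv']
  obtain ⟨h1, _⟩ := isGaloisPoint_iff_of_middle_ne_zero hq (by omega) hC (hv' ▸ hv)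
    (by simpa using sub_ne_zero.2 ha1) rfl
  intro h
  exact RatFunc.not_normal_adjoin_trinomials p hp hqp hq hm ha0 ha1 rfl (h1.1 h).to_normal

end PlaneCurve

end

/-! ### The main theorem -/

theorem theorem1 {k : Type*} [Field k] [IsAlgClosed k] (p : ℕ) [CharP k p]
    (hp : p.Prime) (hp3 : 3 ≤ p) (q n : ℕ) (hq : q = p ^ n) (hq5 : 5 ≤ q) :
    (∃ C : PlaneCurve k,
      C.points = Set.range (phi (k := k) q (odd_of_eq_prime_pow hp hp3 hq))) ∧
    ∀ C : PlaneCurve k,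
      C.points = Set.range (phi (k := k) q (odd_of_eq_prime_pow hp hp3 hq)) →
      ∀ P₁ P₂ : ℙ k (Fin 3 → k),
        P₁ = planePoint 0 1 0 (by simp) → P₂ = planePoint 1 0 0 (by simp) →
        C.degree = q ∧
        (P₁ = phi q (odd_of_eq_prime_pow hp hp3 hq) (linePoint 0 1 (by simp)) ∧
          C.IsInnerGaloisPoint P₁ ∧
          Nonempty (C.galoisGroup P₁ ≃* DihedralGroup ((q - 1) / 2))) ∧
        (P₂ = phi q (odd_of_eq_prime_pow hp hp3 hq) (linePoint 1 1 (by simp)) ∧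
          C.IsInnerGaloisPoint P₂ ∧
          Nonempty (C.galoisGroup P₂ ≃* Multiplicative (ZMod (q - 1)))) ∧
        {P | C.IsInnerGaloisPoint P} = {P₁, P₂} ∧
        {P | C.IsInnerGaloisPoint P}.ncard = 2 := by
  have hodd := odd_of_eq_prime_pow hp hp3 hq
  obtain ⟨m, hm⟩ := hodd
  have hm2 : 2 ≤ m := by omega
  have hm0 : m ≠ 0 := by omega
  have : Fact p.Prime := ⟨hp⟩
  refine ⟨PlaneCurve.exists_points_eq_range_phi _ hm hm0, ?_⟩
  rintro Γ hC P₁ P₂ hP₁ hP₂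
  have hn : n ≠ 0 := by
    rintro rfl
    simp at hq
    omega
  have hq0 : (2 : k) * m + 1 = 0 := by
    have h1 : ((2 * m + 1 : ℕ) : k) = 0 := by
      rw [← hm, hq, Nat.cast_pow, CharP.cast_eq_zero, zero_pow hn]
    exact_mod_cast h1
  have h2m : ((2 * m : ℕ) : k) ≠ 0 := by
    intro h
    push_cast at h
    rw [h] at hq0
    simp at hq0
  have hmk : (m : k) ≠ 0 := by
    intro h
    apply h2m
    push_cast
    rw [h, mul_zero]
  obtain ⟨hdeg, c, hc⟩ := PlaneCurve.degree_eq_and_exists_curveForm_eq p hq hm hm0 hC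
  obtain ⟨hG₁, hiso₁⟩ := PlaneCurve.isGaloisPoint_first hm hmk hC
  obtain ⟨hG₂, hiso₂⟩ := PlaneCurve.isGaloisPoint_second p hq hm h2m hC
  rw [← hP₁] at hG₁ hiso₁
  rw [← hP₂] at hG₂ hiso₂
  have hphi₁ : P₁ = phi q (odd_of_eq_prime_pow hp hp3 hq) (linePoint 0 1 (by simp)) := by
    rw [hP₁, planePoint, linePoint, PlaneCurve.phi_mk, Projectivization.mk_eq_mk_iff']
    -- The vector representing φ₁(0 : 1) is (0, -1, 0).
    refine ⟨-1, ?_⟩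
    rw [phiVec_odd hm]
    funext i
    fin_cases i <;> simp
  have hphi₂ : P₂ = phi q (odd_of_eq_prime_pow hp hp3 hq) (linePoint 1 1 (by simp)) := by
    rw [hP₂, planePoint, linePoint, PlaneCurve.phi_mk, Projectivization.mk_eq_mk_iff']
    refine ⟨1, ?_⟩
    rw [phiVec_odd hm]
    funext i
    fin_cases i <;> simp
  have hmem₁ : P₁ ∈ Γ.points := hC ▸ ⟨_, hphi₁.symm⟩
  have hmem₂ : P₂ ∈ Γ.points := hC ▸ ⟨_, hphi₂.symm⟩
  have hin₁ : Γ.IsInnerGaloisPoint P₁ := by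
    refine ⟨hG₁, ?_⟩
    subst hP₁
    exact PlaneCurve.isSmoothPoint_mk _ hmem₁ hc (PlaneCurve.eval_pderiv_zero_curveForm hm0)
  have hin₂ : Γ.IsInnerGaloisPoint P₂ := by
    refine ⟨hG₂, ?_⟩
    subst hP₂
    exact PlaneCurve.isSmoothPoint_mk _ hmem₂ hc (PlaneCurve.eval_pderiv_two_curveForm m)
  have hne : P₁ ≠ P₂ := by
    rw [hP₁, hP₂, planePoint, planePoint, Ne, Projectivization.mk_eq_mk_iff']
    rintro ⟨a, ha⟩
    have := congrFun ha 1
    simp at this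
  have hset : {P | Γ.IsInnerGaloisPoint P} = {P₁, P₂} := by
    ext P
    constructor
    · rintro ⟨hGal, hmem, _⟩
      rw [hC] at hmem
      obtain ⟨L, rfl⟩ := hmem
      induction L using Projectivization.ind with
      | h v hv =>
        -- The parameter (1 : 0) gives (0 : 0 : 1); all others are (a : 1), with a = 0 and a = 1
        -- giving P₁ and P₂.
        by_cases hv1 : v 1 = 0
        · exfalso
          apply PlaneCurve.not_isGaloisPoint_at_infinity hm hm2 hC
          convert hGal using 1
          rw [planePoint, PlaneCurve.phi_mk, eq_comm, Projectivization.mk_eq_mk_iff']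
          refine ⟨v 0 ^ q, ?_⟩
          have hv' : v = ![v 0, 0] := by
            funext i
            fin_cases i
            · rfl
            · exact hv1
          rw [hv', phiVec_odd hm]
          funext i
          fin_cases i <;> simp [hm0, hm]
        · obtain ⟨a, hline⟩ : ∃ a, Projectivization.mk k v hv = linePoint a 1 (by simp) := by
            refine ⟨v 0 / v 1, ?_⟩
            rw [linePoint, Projectivization.mk_eq_mk_iff']
            refine ⟨v 1, ?_⟩
            funext i
            fin_cases i <;> simp [mul_div_cancel₀ _ hv1]
          rw [hline] at hGal ⊢
          by_cases ha0 : a = 0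
          · subst ha0
            exact Or.inl hphi₁.symm
          · by_cases ha1 : a = 1
            · subst ha1
              exact Or.inr hphi₂.symm
            · rw [linePoint, PlaneCurve.phi_mk] at hGal
              exact absurd hGal (PlaneCurve.not_isGaloisPoint_of_ne p hp hq hm hm2 hC ha0 ha1 _)
    · rintro (rfl | rfl)
      · exact hin₁
      · exact hin₂
  have e1 : (q - 1) / 2 = m := by omega
  have e2 : q - 1 = 2 * m := by omega
  rw [e1, e2]
  refine ⟨hdeg, ⟨hphi₁, hin₁, hiso₁⟩, ⟨hphi₂, hin₂, hiso₂⟩, hset, ?_⟩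
  rw [hset, Set.ncard_pair hne]
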